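/- Let $K$ be a field, $S=K[X_1,\dots,X_n]$ with the standard grading, $I\subset S$ a monomial ideal (an ideal generated by monomials), $R=S/I$, $d=\dim R$ the Krull dimension, and $\mathfrak m=(x_1,\dots,x_n)$ the ideal of $R$ generated by the residue classes of the variables. For $i\ge 0$ let $H^i_{\mathfrak m}(R)$ be the $i$-th local cohomology module of $R$ with respect to $\mathfrak m$, realized as the $i$-th cohomology of the Čech complex $0\to R\to\bigoplus_i R_{x_i}\to\bigoplus_{i<j}R_{x_ix_j}\to\cdots\to R_{x_1\cdots x_n}\to 0$ and equipped with the $\mathbb Z$-grading $H^i_{\mathfrak m}(R)=\bigoplus_{j\in\mathbb Z}H^i_{\mathfrak m}(R)_j$ induced by the standard grading of $S$. Suppose that $I$ is generalized Cohen–Macaulay, that is, $H^i_{\mathfrak m}(R)$ has finite length for every $i\ne d$. Let $$r=\operatorname{reg}(R)=\max\{\,i+j \mid H^i_{\mathfrak m}(R)_j\neq 0\,\}$$ be the Castelnuovo–Mumford regularity of $R$ (with $\operatorname{reg}(0)=-\infty$). Then $$H^i_{\mathfrak m}(R)=0\quad\text{for all } i \text{ with } r+1\le i<d .$$ In particular,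 if for some integer $q\ge 0$ the ideal $I$ has a $q$-linear resolution, that is, its minimal graded free resolution has the form $\cdots\to S(-q-2)^{\beta_2}\to S(-q-1)^{\beta_1}\to S(-q)^{\beta_0}\to I\to 0$, then $$H^i_{\mathfrak m}(R)=0\quad\text{for all } i \text{ with } q\le i<d .$$ -/

import Mathlib

open MvPolynomial

noncomputable section

/-! ### The Čech complex of a module and local cohomology -/

section Cech

variable {A : Type*} [CommRing A] {ι : Type*} [LinearOrder ι] (x : ι → A)
  (M : Type*) [AddCommGroup M] [Module A M]

/-- The localization `M_{x_F}` of `M` at the powers of the product `x_F = ∏_{i ∈ F} x_i`. -/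
abbrev CechLoc (F : Finset ι) : Type _ :=
  LocalizedModule (Submonoid.powers (∏ i ∈ F, x i)) M

/-- If `F ⊆ G`, then every power of `x_F` acts invertibly on `M_{x_G}`. -/
theorem cechLoc_isUnit {F G : Finset ι} (h : F ⊆ G)
    (s : Submonoid.powers (∏ i ∈ F, x i)) :
    IsUnit (algebraMap A (Module.End A (CechLoc x M G)) s) := by
  obtain ⟨_, k, rfl⟩ := s
  have hG : IsUnit (algebraMap A (Module.End A (CechLoc x M G)) (∏ i ∈ G, x i)) :=
    IsLocalizedModule.map_units (LocalizedModule.mkLinearMap _ M)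
      (⟨_, Submonoid.mem_powers _⟩ : Submonoid.powers (∏ i ∈ G, x i))
  have hp : ∏ i ∈ G, x i = (∏ i ∈ F, x i) * ∏ i ∈ G \ F, x i := by
    rw [mul_comm, Finset.prod_sdiff h]
  have hG' := (congrArg (fun a => IsUnit (algebraMap A (Module.End A (CechLoc x M G)) a))
    hp).mp hG
  simp only [map_mul] at hG'
  have hc : Commute (algebraMap A (Module.End A (CechLoc x M G)) (∏ i ∈ F, x i))
      (algebraMap A (Module.End A (CechLoc x M G)) (∏ i ∈ G \ F, x i)) :=
    Algebra.commutes _ _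
  simp only [map_pow]
  exact (hc.isUnit_mul_iff.mp hG').1.pow k

/-- The natural map `M_{x_F} → M_{x_G}` for `F ⊆ G`, sending `m / 1` to `m / 1`. -/
def cechLocMap {F G : Finset ι} (h : F ⊆ G) : CechLoc x M F →ₗ[A] CechLoc x M G :=
  LocalizedModule.lift _ (LocalizedModule.mkLinearMap _ M) (cechLoc_isUnit x M h)

/-- The module `C^t = ⨁_{i_1 < ⋯ < i_t} M_{x_{i_1} ⋯ x_{i_t}}` of Čech cochains (there are
finitely many summands as soon as `ι` is finite). -/
abbrev CechCochain (t : ℕ) : Type _ :=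
  (F : {F : Finset ι // F.card = t}) → CechLoc x M F.1

/-- The Čech differential `C^t → C^{t+1}`: its component from `F = G \ {i}` to `G` is
`(-1)^s` times the natural map, where `i` is the element number `s` of `G` in increasing order,
counted from `0`. -/
def cechD (t : ℕ) : CechCochain x M t →ₗ[A] CechCochain x M (t + 1) :=
  LinearMap.pi fun G =>
    ∑ i : {i // i ∈ G.1},
      (-1 : A) ^ (G.1.filter (· < i.1)).card •
        (cechLocMap x M (G.1.erase_subset i.1)).comp
          (LinearMap.proj (⟨G.1.erase i.1, by
            rw [Finset.card_erase_of_mem i.2, G.2, Nat.add_sub_cancel]⟩ :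
              {F : Finset ι // F.card = t}))

/-- The cocycles in `C^t`. -/
abbrev cechCocycles (t : ℕ) : Submodule A (CechCochain x M t) :=
  LinearMap.ker (cechD x M t)

/-- The coboundaries in `C^t`; there are none but `0` in degree `0`. -/
def cechBoundaries : (t : ℕ) → Submodule A (CechCochain x M t)
  | 0 => ⊥
  | t + 1 => LinearMap.range (cechD x M t)

/-- The cohomology `H^t` of the Čech complex of `M` with respect to the sequence `x`, that is,
the local cohomology of `M` with support in the ideal generated by `x` (for `A` Noetherian). -/
abbrev CechCohomology (t : ℕ) : Type _ :=
  cechCocycles x M t ⧸ (cechBoundaries x M t).submoduleOf (cechCocycles x M t)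

end Cech

/-! ### Local cohomology of `R = S / I` for `S = K[X_1, …, X_n]`, and its grading -/

section Graded

variable {K : Type*} [Field K] {n : ℕ}

/-- A monomial ideal: an ideal generated by a set of monomials `X^a`. -/
def IsMonomialIdeal (I : Ideal (MvPolynomial (Fin n) K)) : Prop :=
  ∃ E : Set (Fin n →₀ ℕ), I = Ideal.span ((fun a => monomial a (1 : K)) '' E)

/-- The local cohomology module `H^i_𝔪(R)` of `R = S / I` with respect to
`𝔪 = (x_1, …, x_n)`, as the cohomology of the Čech complex
`0 → R → ⨁ R_{x_i} → ⨁ R_{x_i x_j} → ⋯ → R_{x_1 ⋯ x_n} → 0`. -/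
abbrev LocalCoh (I : Ideal (MvPolynomial (Fin n) K)) (i : ℕ) : Type _ :=
  CechCohomology (X : Fin n → MvPolynomial (Fin n) K) (MvPolynomial (Fin n) K ⧸ I) i

/-- All terms of the polynomial `f` have the (integer) degree `e`; for `e < 0` this says `f = 0`. -/
def HasDegree (f : MvPolynomial (Fin n) K) (e : ℤ) : Prop :=
  ∀ a ∈ f.support, (a.degree : ℤ) = e

theorem HasDegree.zero (e : ℤ) : HasDegree (0 : MvPolynomial (Fin n) K) e := by
  simp [HasDegree]

theorem HasDegree.neg {f : MvPolynomial (Fin n) K} {e : ℤ} (hf : HasDegree f e) :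
    HasDegree (-f) e := by
  simpa [HasDegree] using hf

theorem HasDegree.add {f g : MvPolynomial (Fin n) K} {e : ℤ} (hf : HasDegree f e)
    (hg : HasDegree g e) : HasDegree (f + g) e := by
  classical
  intro a ha
  rcases Finset.mem_union.mp (support_add ha) with h | h
  exacts [hf a h, hg a h]

theorem HasDegree.mul {f g : MvPolynomial (Fin n) K} {d e : ℤ} (hf : HasDegree f d)
    (hg : HasDegree g e) : HasDegree (f * g) (d + e) := by
  classical
  intro a ha
  obtain ⟨b, hb, c, hc, rfl⟩ := Finset.mem_add.mp (support_mul f g ha)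
  rw [map_add, Nat.cast_add, hf b hb, hg c hc]

theorem HasDegree.prod_X_pow (F : Finset (Fin n)) (k : ℕ) :
    HasDegree ((∏ i ∈ F, X i : MvPolynomial (Fin n) K) ^ k) (k * F.card) := by
  have h : ((∏ i ∈ F, X i : MvPolynomial (Fin n) K) ^ k).IsHomogeneous (F.card * k) := by
    have := (IsHomogeneous.prod F (fun i => (X i : MvPolynomial (Fin n) K)) (fun _ => 1)
      fun i _ => isHomogeneous_X K i).pow k
    simpa using this
  intro a ha
  have h' : a.degree = F.card * k := by
    rw [Finsupp.degree_eq_weight_one]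
    exact h (mem_support_iff.mp ha)
  rw [h']
  push_cast
  ring

/-- The component of degree `j ∈ ℤ` of `R_{x_F}`, `R = S / I`: the fractions `f / x_F^k` with
`f` homogeneous of degree `j + k |F|`. -/
def locDegreePart (I : Ideal (MvPolynomial (Fin n) K)) (F : Finset (Fin n)) (j : ℤ) :
    AddSubgroup (CechLoc (X : Fin n → MvPolynomial (Fin n) K) (MvPolynomial (Fin n) K ⧸ I) F) where
  carrier := {y | ∃ (k : ℕ) (f : MvPolynomial (Fin n) K), HasDegree f (j + k * F.card) ∧
    y = LocalizedModule.mk (Ideal.Quotient.mk I f) (Submonoid.pow (∏ i ∈ F, X i) k)}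
  zero_mem' := ⟨0, 0, HasDegree.zero _, by rw [map_zero, LocalizedModule.zero_mk]⟩
  neg_mem' := by
    rintro _ ⟨k, f, hf, rfl⟩
    exact ⟨k, -f, hf.neg, by rw [map_neg, LocalizedModule.mk_neg]⟩
  add_mem' := by
    rintro _ _ ⟨k, f, hf, rfl⟩ ⟨l, g, hg, rfl⟩
    refine ⟨k + l, (∏ i ∈ F, X i) ^ l * f + (∏ i ∈ F, X i) ^ k * g, ?_, ?_⟩
    · have h1 := (HasDegree.prod_X_pow F l).mul hf
      have h2 := (HasDegree.prod_X_pow F k).mul hg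
      refine HasDegree.add ?_ ?_
      · convert! h1 using 1
        push_cast
        ring
      · convert! h2 using 1
        push_cast
        ring
    · rw [LocalizedModule.mk_add_mk]
      congr 1
      exact Subtype.ext (pow_add _ _ _).symm

/-- The component `H^i_𝔪(R)_j` of degree `j` of the local cohomology module: the classes of the
cocycles all of whose entries are homogeneous of degree `j`. -/
def localCohDegreePart (I : Ideal (MvPolynomial (Fin n) K)) (i : ℕ) (j : ℤ) :
    AddSubgroup (LocalCoh I i) where
  carrier := {z | ∃ c : cechCocycles (X : Fin n → MvPolynomial (Fin n) K)
      (MvPolynomial (Fin n) K ⧸ I) i,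
    (∀ F, c.1 F ∈ locDegreePart I F.1 j) ∧ z = Submodule.Quotient.mk c}
  zero_mem' := ⟨0, fun F => (locDegreePart I F.1 j).zero_mem, rfl⟩
  neg_mem' := by
    rintro _ ⟨c, hc, rfl⟩
    exact ⟨-c, fun F => (locDegreePart I F.1 j).neg_mem (hc F), rfl⟩
  add_mem' := by
    rintro _ _ ⟨c, hc, rfl⟩ ⟨c', hc', rfl⟩
    exact ⟨c + c', fun F => (locDegreePart I F.1 j).add_mem (hc F) (hc' F), rfl⟩

/-- `R = S / I` is a generalized Cohen–Macaulay ring: `H^i_𝔪(R)` has finite length for all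
`i ≠ dim R`. -/
def IsGeneralizedCM (I : Ideal (MvPolynomial (Fin n) K)) : Prop :=
  ∀ i : ℕ, (i : WithBot ℕ∞) ≠ ringKrullDim (MvPolynomial (Fin n) K ⧸ I) →
    IsFiniteLength (MvPolynomial (Fin n) K) (LocalCoh I i)

/-- The Castelnuovo–Mumford regularity `reg(R) = max {i + j | H^i_𝔪(R)_j ≠ 0}` of `R = S / I`,
as a supremum in `ℤ ∪ {-∞, ∞}`. -/
def reg (I : Ideal (MvPolynomial (Fin n) K)) : WithBot (WithTop ℤ) :=
  sSup {r | ∃ (i : ℕ) (j : ℤ), localCohDegreePart I i j ≠ ⊥ ∧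
    r = (((i + j : ℤ) : WithTop ℤ) : WithBot (WithTop ℤ))}

/-- `I` has a `q`-linear resolution: there is an exact complex
`⋯ → S(-q-2)^{β_2} → S(-q-1)^{β_1} → S(-q)^{β_0} → I → 0` of graded modules. Here `g` lists the
images of the basis of `S(-q)^{β_0}`, which are forms of degree `q`, and `φ k` is the matrix of
`S(-q-k-1)^{β_{k+1}} → S(-q-k)^{β_k}`, whose entries are linear forms. (As the entries lie in the
maximal ideal `𝔪`, such a complex is the minimal graded free resolution of `I`.) -/
def HasLinearResolution (I : Ideal (MvPolynomial (Fin n) K)) (q : ℕ) : Prop :=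
  ∃ (β : ℕ → ℕ) (g : Fin (β 0) → MvPolynomial (Fin n) K)
    (φ : ∀ k, Matrix (Fin (β k)) (Fin (β (k + 1))) (MvPolynomial (Fin n) K)),
    (∀ a, (g a).IsHomogeneous q) ∧
    (∀ k a b, (φ k a b).IsHomogeneous 1) ∧
    Ideal.span (Set.range g) = I ∧
    LinearMap.ker (Fintype.linearCombination (MvPolynomial (Fin n) K) g) =
      LinearMap.range (φ 0).mulVecLin ∧
    ∀ k, LinearMap.ker (φ k).mulVecLin = LinearMap.range (φ (k + 1)).mulVecLin

end Graded

end

/-! Since `I` is monomial, the Čech complex of `R = S/I` is `ℤ^n`-graded, and `R_{x_F}` lives in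
degrees `v` with `v_l ≥ 0` for `l ∉ F`. The part of a cocycle with `v_l < 0` therefore lives on sets
`F` containing `l`, where `x_l` is invertible, so it is `x_l^N` times a cocycle for every `N`. On
the other hand every Čech class is killed by a power of `x_l`, and if `H^i` has finite length, one
power kills all classes. So this part is a coboundary (`mem_range_of_isNoetherian`). Hence for `i <
d` the module `H^i` lives in degrees `v ≥ 0`, and it vanishes as soon as its components of total
degree `j ≥ 0` do (`subsingleton_localCoh`). If `H^i_j ≠ 0` with `j ≥ 0`, then `i ≤ i + j ≤ r`,
which excludes `i ≥ r + 1`.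

For a `q`-linear resolution it then suffices that `H^i_j = 0` whenever `i < n` and `i + j ≥ q`
(`localCohDegreePart_eq_bot`). A homogeneous cocycle is pushed along the resolution: each lift
raises the cochain degree by one and lowers the internal degree by one (by `q` at the first lift to
the generators). This ends in top cohomology of a free module in a degree greater than `-n`, which
is zero (`mem_range_of_degEq`). The way back uses that the cohomology of a free module vanishes
below `n` (`mem_range_of_lt`). Both facts come from an explicit contraction of the part with `v_l ≥
0` (`totPart_nonneg_mem_range`). -/

set_option linter.unusedSectionVars false

noncomputable section

/-! ### The Čech complex with all cochain degrees at once, indexed by arbitrary finite sets. -/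

section TotalComplex

variable {A : Type*} [CommRing A] {ι : Type*} [LinearOrder ι] (x : ι → A)
  (M : Type*) [AddCommGroup M] [Module A M]

/-- The fraction `m / x_F ^ k` in `M_{x_F}`. -/
abbrev cechFrac {M : Type*} [AddCommGroup M] [Module A M] (F : Finset ι) (m : M) (k : ℕ) :
    CechLoc x M F :=
  LocalizedModule.mk m (Submonoid.pow (∏ i ∈ F, x i) k)

variable {M} in
theorem exists_cechFrac {F : Finset ι} (y : CechLoc x M F) : ∃ m k, y = cechFrac x F m k := by
  induction y using LocalizedModule.induction_on with
  | h m s =>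
    obtain ⟨_, k, rfl⟩ := s
    exact ⟨m, k, rfl⟩

variable {M} in
theorem cechFrac_eq_iff {F : Finset ι} {m m' : M} {k k' : ℕ} :
    cechFrac x F m k = cechFrac x F m' k' ↔
      ∃ u, (∏ i ∈ F, x i) ^ (u + k') • m = (∏ i ∈ F, x i) ^ (u + k) • m' := by
  have key : ∀ a b (n : M), Submonoid.pow (∏ i ∈ F, x i) a • Submonoid.pow (∏ i ∈ F, x i) b • n =
      (∏ i ∈ F, x i) ^ (a + b) • n := by
    intro a b n
    rw [pow_add, mul_smul]
    rfl
  rw [LocalizedModule.mk_eq]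
  constructor
  · rintro ⟨⟨_, u, rfl⟩, h⟩
    exact ⟨u, by rw [← key, ← key]; exact h⟩
  · rintro ⟨u, h⟩
    exact ⟨Submonoid.pow _ u, by rw [key, key, h]⟩

variable {M} in
theorem cechFrac_add {F : Finset ι} (m : M) (k l : ℕ) :
    cechFrac x F ((∏ i ∈ F, x i) ^ l • m) (k + l) = cechFrac x F m k := by
  rw [cechFrac_eq_iff]
  exact ⟨0, by rw [smul_smul, ← pow_add]; congr 2; omega⟩

variable {M} in
theorem exists_cechFrac₂ {F : Finset ι} (y z : CechLoc x M F) :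
    ∃ m m' k, y = cechFrac x F m k ∧ z = cechFrac x F m' k := by
  obtain ⟨m, k, rfl⟩ := exists_cechFrac x y
  obtain ⟨m', k', rfl⟩ := exists_cechFrac x z
  refine ⟨(∏ i ∈ F, x i) ^ k' • m, (∏ i ∈ F, x i) ^ k • m', k + k', ?_, ?_⟩
  · rw [cechFrac_add]
  · rw [add_comm, cechFrac_add]

variable {M} in
theorem cechFrac_add_cechFrac {F : Finset ι} (m m' : M) (k : ℕ) :
    cechFrac x F m k + cechFrac x F m' k = cechFrac x F (m + m') k := by
  rw [LocalizedModule.mk_add_mk, ← smul_add]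
  exact LocalizedModule.mk_cancel_common_left _ _ _

variable {M} in
@[simp]
theorem cechFrac_zero {F : Finset ι} (k : ℕ) : cechFrac x F (0 : M) k = 0 :=
  LocalizedModule.zero_mk _

variable {M} in
theorem smul_cechFrac {F : Finset ι} (a : A) (m : M) (k : ℕ) :
    a • cechFrac x F m k = cechFrac x F (a • m) k :=
  LocalizedModule.smul'_mk _ _ _

theorem cechLoc_isUnit_of_mem {F : Finset ι} {l : ι} (hl : l ∈ F) :
    IsUnit (algebraMap A (Module.End A (CechLoc x M F)) (x l)) := by
  have h := cechLoc_isUnit x M (Finset.singleton_subset_iff.mpr hl) (Submonoid.pow _ 1)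
  simpa [Submonoid.pow] using h

theorem smul_pow_bijective {F : Finset ι} {l : ι} (hl : l ∈ F) (k : ℕ) :
    Function.Bijective fun y : CechLoc x M F => x l ^ k • y := by
  have h := (cechLoc_isUnit_of_mem x M hl).pow k
  rw [← map_pow, Module.End.isUnit_iff] at h
  exact h

theorem smul_pow_prod_injective {F : Finset ι} (k : ℕ) :
    Function.Injective fun y : CechLoc x M F => (∏ i ∈ F, x i) ^ k • y := by
  have h := cechLoc_isUnit x M (subset_refl F) (Submonoid.pow _ k)
  rw [Module.End.isUnit_iff] at h
  exact h.1

/-- Multiplication by `x_F ^ k` is bijective on `M_{x_G}`, and it turns both sides into `m / 1`. -/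
theorem cechLocMap_cechFrac {F G : Finset ι} (h : F ⊆ G) (m : M) (k : ℕ) :
    cechLocMap x M h (cechFrac x F m k) = cechFrac x G ((∏ i ∈ G \ F, x i) ^ k • m) k := by
  have h1 : (∏ i ∈ F, x i) ^ k • cechFrac x F m k = cechFrac x F m 0 := by
    rw [smul_cechFrac]
    simpa using cechFrac_add x m 0 k
  have h2 : cechLocMap x M h (cechFrac x F m 0) = cechFrac x G m 0 := by
    have : ∀ H : Finset ι, cechFrac x H m 0 = LocalizedModule.mkLinearMap _ M m := by
      intro H
      have e : Submonoid.pow (∏ i ∈ H, x i) 0 = 1 := by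
        apply Subtype.ext
        exact pow_zero (∏ i ∈ H, x i)
      rw [cechFrac, e, LocalizedModule.mkLinearMap_apply]
    rw [this, this]
    exact LocalizedModule.lift_mk_one _ _ _ _
  have h3 : (∏ i ∈ F, x i) ^ k • cechFrac x G ((∏ i ∈ G \ F, x i) ^ k • m) k
      = cechFrac x G m 0 := by
    rw [smul_cechFrac, smul_smul, ← mul_pow, mul_comm, Finset.prod_sdiff h]
    simpa using cechFrac_add x m 0 k
  have h4 := (Module.End.isUnit_iff _).mp (cechLoc_isUnit x M h (Submonoid.pow _ k))
  apply h4.1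
  change (∏ i ∈ F, x i) ^ k • cechLocMap x M h (cechFrac x F m k) = (∏ i ∈ F, x i) ^ k •
    cechFrac x G ((∏ i ∈ G \ F, x i) ^ k • m) k
  rw [h3, ← map_smul, h1, h2]

theorem cechLocMap_comp {F G H : Finset ι} (h : F ⊆ G) (h' : G ⊆ H) (y : CechLoc x M F) :
    cechLocMap x M h' (cechLocMap x M h y) = cechLocMap x M (h.trans h') y := by
  obtain ⟨m, k, rfl⟩ := exists_cechFrac x y
  rw [cechLocMap_cechFrac, cechLocMap_cechFrac, cechLocMap_cechFrac, smul_smul, ← mul_pow]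
  congr 3
  rw [← Finset.prod_union, Finset.sdiff_union_sdiff_cancel h' h]
  exact Finset.disjoint_of_subset_right Finset.sdiff_subset Finset.sdiff_disjoint

/-- Cochains of all degrees: families of elements of the modules `M_{x_F}`. -/
abbrev TotCochain : Type _ := (F : Finset ι) → CechLoc x M F

variable {M} in
theorem cechLocMap_congr (c : TotCochain x M) {F F' G : Finset ι} (h : F ⊆ G) (h' : F' ⊆ G)
    (e : F = F') : cechLocMap x M h (c F) = cechLocMap x M h' (c F') := by
  subst e
  rfl

/-- The sign with which `G \ {i}` contributes to `G`. -/
def cechSign (i : ι) (G : Finset ι) : A := (-1) ^ (G.filter (· < i)).card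

theorem cechSign_mul_self (i : ι) (G : Finset ι) :
    (cechSign i G : A) * cechSign i G = 1 := by
  rw [cechSign, ← mul_pow]
  simp

theorem cechSign_insert_of_lt {i j : ι} {G : Finset ι} (hj : j ∉ G) (h : j < i) :
    (cechSign i (insert j G) : A) = -cechSign i G := by
  rw [cechSign, cechSign, Finset.filter_insert, if_pos h,
    Finset.card_insert_of_notMem (by simp [hj]), pow_succ]
  ring

theorem cechSign_insert_of_not_lt {i j : ι} {G : Finset ι} (h : ¬ j < i) :
    (cechSign i (insert j G) : A) = cechSign i G := by
  rw [cechSign, cechSign, Finset.filter_insert, if_neg h]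

theorem cechSign_insert_self (i : ι) (G : Finset ι) :
    (cechSign i (insert i G) : A) = cechSign i G :=
  cechSign_insert_of_not_lt (lt_irrefl i)

/-- Inserting the smaller of `i`, `j` flips the sign of the larger one, while inserting the larger
leaves the sign of the smaller unchanged. This single sign change is what makes the differential
square to zero. -/
theorem cechSign_swap {i j : ι} {G : Finset ι} (hi : i ∉ G) (hj : j ∉ G) (hij : i ≠ j) :
    (cechSign i (insert j G) : A) * cechSign j G = -(cechSign j (insert i G) * cechSign i G) := by
  rcases lt_or_gt_of_ne hij with h | h
  · rw [cechSign_insert_of_not_lt (not_lt_of_gt h), cechSign_insert_of_lt hi h]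
    ring
  · rw [cechSign_insert_of_not_lt (not_lt_of_gt h), cechSign_insert_of_lt hj h]
    ring

/-- The Čech differential on cochains of all degrees. -/
def totD : TotCochain x M →ₗ[A] TotCochain x M :=
  LinearMap.pi fun G => ∑ i ∈ G, (cechSign i G : A) •
    (cechLocMap x M (G.erase_subset i)).comp (LinearMap.proj (G.erase i))

variable {M}

theorem totD_apply (c : TotCochain x M) (G : Finset ι) :
    totD x M c G = ∑ i ∈ G, (cechSign i G : A) •
      cechLocMap x M (G.erase_subset i) (c (G.erase i)) := by
  simp [totD]

theorem totD_totD (c : TotCochain x M) : totD x M (totD x M c) = 0 := by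
  funext G
  rw [totD_apply]
  simp only [totD_apply, map_sum, map_smul, cechLocMap_comp, Finset.smul_sum, smul_smul]
  rw [Finset.sum_sigma', Pi.zero_apply]
  -- Removing `i` and then `j` cancels against removing `j` and then `i`.
  refine Finset.sum_involution (fun p _ => ⟨p.2, p.1⟩) ?_ ?_ ?_ ?_
  · rintro ⟨i, j⟩ hp
    simp only [Finset.mem_sigma, Finset.mem_erase] at hp
    obtain ⟨hi, hji, hj⟩ := hp
    dsimp only
    rw [cechLocMap_congr x c _ (((G.erase j).erase_subset i).trans (G.erase_subset j))
      Finset.erase_right_comm, ← add_smul]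
    set G' := (G.erase j).erase i with hG'
    have e1 : G.erase j = insert i G' := by
      rw [hG', Finset.insert_erase (Finset.mem_erase.mpr ⟨hji.symm, hi⟩)]
    have e2 : G.erase i = insert j G' := by
      rw [hG', Finset.erase_right_comm, Finset.insert_erase (Finset.mem_erase.mpr ⟨hji, hj⟩)]
    have hi' : i ∉ G' := by simp [hG']
    have hj' : j ∉ G' := by simp [hG']
    have e3 : G = insert j (insert i G') := by rw [← e1, Finset.insert_erase hj]
    have s1 : (cechSign i G : A) = cechSign i (insert j G') := by
      rw [e3, Finset.insert_comm, cechSign_insert_self]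
    have s2 : (cechSign j G : A) = cechSign j (insert i G') := by
      rw [e3, cechSign_insert_self]
    have s3 : (cechSign j (G.erase i) : A) = cechSign j G' := by rw [e2, cechSign_insert_self]
    have s4 : (cechSign i (G.erase j) : A) = cechSign i G' := by rw [e1, cechSign_insert_self]
    rw [s1, s2, s3, s4, cechSign_swap hi' hj' hji.symm, neg_add_cancel, zero_smul]
  · rintro ⟨i, j⟩ hp - h
    simp only [Finset.mem_sigma, Finset.mem_erase] at hp
    exact hp.2.1 (congrArg Sigma.fst h)
  · rintro ⟨i, j⟩ hp
    simp only [Finset.mem_sigma, Finset.mem_erase] at hp ⊢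
    exact ⟨hp.2.2, hp.2.1.symm, hp.1⟩
  · rintro ⟨i, j⟩ hp
    rfl

/-- If `b` vanishes on all sets that contain `l`, only one term of the differential is left. -/
theorem totD_insert_of_forall_mem {b : TotCochain x M} {l : ι} (hb : ∀ F, l ∈ F → b F = 0)
    {G : Finset ι} (hl : l ∉ G) :
    totD x M b (insert l G) =
      (cechSign l G : A) • cechLocMap x M (Finset.subset_insert l G) (b G) := by
  rw [totD_apply, Finset.sum_eq_single l]
  · rw [cechSign_insert_self]
    congr 1
    exact cechLocMap_congr x b _ _ (Finset.erase_insert hl)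
  · intro i hi hil
    rw [hb _ (Finset.mem_erase.mpr ⟨hil.symm, Finset.mem_insert_self l G⟩), map_zero, smul_zero]
  · simp

/-- If `b` vanishes on all sets that do not contain `l`, so does its differential. -/
theorem totD_eq_zero_of_notMem {b : TotCochain x M} {l : ι} (hb : ∀ F, l ∉ F → b F = 0)
    {G : Finset ι} (hl : l ∉ G) : totD x M b G = 0 := by
  rw [totD_apply]
  refine Finset.sum_eq_zero fun i _ => ?_
  rw [hb _ fun h => hl (Finset.mem_of_mem_erase h), map_zero, smul_zero]

/-- The cochain `c` is supported in cardinality `t`. -/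
def SuppCard (t : ℕ) (c : TotCochain x M) : Prop := ∀ F, F.card ≠ t → c F = 0

/-- The part of a cochain in cardinality `t`. -/
def resCard (t : ℕ) (c : TotCochain x M) : TotCochain x M :=
  fun F => if F.card = t then c F else 0

theorem suppCard_resCard (t : ℕ) (c : TotCochain x M) : SuppCard x t (resCard x t c) :=
  fun _ h => if_neg h

variable {x} in
theorem SuppCard.resCard_eq {t : ℕ} {c : TotCochain x M} (h : SuppCard x t c) :
    resCard x t c = c := by
  funext F
  unfold resCard
  split_ifs with hF
  · rfl
  · exact (h F hF).symm

variable {x} in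
theorem SuppCard.sub {t : ℕ} {c c' : TotCochain x M} (h : SuppCard x t c) (h' : SuppCard x t c') :
    SuppCard x t (c - c') := fun F hF => by
  rw [Pi.sub_apply, h F hF, h' F hF, sub_zero]

theorem totD_resCard (t : ℕ) (c : TotCochain x M) :
    totD x M (resCard x t c) = resCard x (t + 1) (totD x M c) := by
  funext G
  rw [resCard, totD_apply]
  split_ifs with h
  · rw [totD_apply]
    refine Finset.sum_congr rfl fun i hi => ?_
    rw [resCard, if_pos (by rw [Finset.card_erase_of_mem hi, h, Nat.add_sub_cancel])]
  · refine Finset.sum_eq_zero fun i hi => ?_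
    rw [resCard, if_neg, map_zero, smul_zero]
    intro h'
    rw [Finset.card_erase_of_mem hi] at h'
    have := Finset.card_pos.mpr ⟨i, hi⟩
    omega

variable {x} in
theorem SuppCard.totD {t : ℕ} {c : TotCochain x M} (h : SuppCard x t c) :
    SuppCard x (t + 1) (totD x M c) := by
  rw [← h.resCard_eq, totD_resCard]
  exact suppCard_resCard x _ _

/-- Extension by zero of a cochain of degree `t`. -/
def extCochain (t : ℕ) : CechCochain x M t →ₗ[A] TotCochain x M where
  toFun c F := if h : F.card = t then c ⟨F, h⟩ else 0
  map_add' c c' := by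
    funext F
    by_cases h : F.card = t <;> simp [h]
  map_smul' a c := by
    funext F
    by_cases h : F.card = t <;> simp [h]

theorem extCochain_apply {t : ℕ} (c : CechCochain x M t) {F : Finset ι} (h : F.card = t) :
    extCochain x t c F = c ⟨F, h⟩ := dif_pos h

theorem suppCard_extCochain {t : ℕ} (c : CechCochain x M t) : SuppCard x t (extCochain x t c) :=
  fun _ h => dif_neg h

/-- The component of degree `t` of a cochain. -/
def restrictCochain (t : ℕ) (c : TotCochain x M) : CechCochain x M t := fun F => c F.1

theorem extCochain_restrictCochain {t : ℕ} (c : TotCochain x M) :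
    extCochain x t (restrictCochain x t c) = resCard x t c := by
  funext F
  unfold resCard
  split_ifs with h
  · rw [extCochain_apply x _ h]; rfl
  · exact suppCard_extCochain x _ F h

theorem extCochain_injective {t : ℕ} : Function.Injective (extCochain x t (M := M)) := by
  intro c c' h
  funext F
  have := congrFun h F.1
  rwa [extCochain_apply x _ F.2, extCochain_apply x _ F.2] at this

theorem cechD_apply {t : ℕ} (c : CechCochain x M t) (G : {F : Finset ι // F.card = t + 1}) :
    cechD x M t c G = totD x M (extCochain x t c) G.1 := by
  rw [totD_apply, ← Finset.sum_coe_sort]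
  simp only [cechD, LinearMap.pi_apply, LinearMap.sum_apply, LinearMap.smul_apply,
    LinearMap.comp_apply, LinearMap.proj_apply]
  refine Finset.sum_congr rfl fun i _ => ?_
  rw [extCochain_apply]
  rfl

theorem extCochain_cechD {t : ℕ} (c : CechCochain x M t) :
    extCochain x (t + 1) (cechD x M t c) = totD x M (extCochain x t c) := by
  funext G
  by_cases h : G.card = t + 1
  · rw [extCochain_apply x _ h, cechD_apply]
  · rw [suppCard_extCochain x _ G h, (suppCard_extCochain x c).totD G h]

theorem mem_cechCocycles_iff {t : ℕ} {c : CechCochain x M t} :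
    c ∈ cechCocycles x M t ↔ totD x M (extCochain x t c) = 0 := by
  rw [LinearMap.mem_ker, ← extCochain_cechD]
  exact ((extCochain_injective x).eq_iff' (map_zero _)).symm

/-- The preimage `b` need not be concentrated in one cardinality: as `totD` raises cardinality by
one, only one component of `b` matters. For `t = 0` the value of `totD` at the empty set is an empty
sum, in accordance with the zero coboundaries. -/
theorem mem_cechBoundaries_iff {t : ℕ} {c : CechCochain x M t} :
    c ∈ cechBoundaries x M t ↔ ∃ b, totD x M b = extCochain x t c := by
  cases t with
  | zero =>
    simp only [cechBoundaries, Submodule.mem_bot]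
    constructor
    · rintro rfl
      exact ⟨0, by rw [map_zero, map_zero]⟩
    · rintro ⟨b, hb⟩
      apply extCochain_injective x
      rw [map_zero, ← (suppCard_extCochain x c).resCard_eq, ← hb]
      funext F
      unfold resCard
      split_ifs with h
      · rw [totD_apply, Finset.card_eq_zero.mp h]
        simp
      · rfl
  | succ t =>
    simp only [cechBoundaries, LinearMap.mem_range]
    constructor
    · rintro ⟨b, rfl⟩
      exact ⟨_, (extCochain_cechD x b).symm⟩
    · rintro ⟨b, hb⟩
      refine ⟨restrictCochain x t b, extCochain_injective x ?_⟩
      rw [extCochain_cechD, extCochain_restrictCochain, totD_resCard, hb,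
        (suppCard_extCochain x c).resCard_eq]

theorem cechCohomology_mk_eq_zero_iff {t : ℕ} (c : cechCocycles x M t) :
    (Submodule.Quotient.mk c : CechCohomology x M t) = 0 ↔
      extCochain x t c.1 ∈ LinearMap.range (totD x M) := by
  rw [Submodule.Quotient.mk_eq_zero, Submodule.submoduleOf, Submodule.mem_comap,
    Submodule.subtype_apply, mem_cechBoundaries_iff]
  rfl

/-- The cohomology class of a cocycle supported in cardinality `t`. -/
theorem exists_cocycle {t : ℕ} {c : TotCochain x M} (hc : SuppCard x t c) (h : totD x M c = 0) :
    ∃ z : cechCocycles x M t, extCochain x t z.1 = c := by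
  have e : extCochain x t (restrictCochain x t c) = c := by
    rw [extCochain_restrictCochain, hc.resCard_eq]
  exact ⟨⟨restrictCochain x t c, (mem_cechCocycles_iff x).mpr (by rw [e, h])⟩, e⟩

end TotalComplex

/-! ### Additive and linear maps between Čech complexes, and exactness. -/

section Maps

variable {A : Type*} [CommRing A] {ι : Type*} [LinearOrder ι] (x : ι → A)
  {M N P : Type*} [AddCommGroup M] [Module A M] [AddCommGroup N] [Module A N]
  [AddCommGroup P] [Module A P]

/-- The hypothesis `hT` says that expanding a fraction by `x_F` in the source expands its image by
`x_{F'}`, so the image does not depend on the representation. The `T k` are only additive because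
projections to graded pieces are not `S`-linear. -/
theorem fracMap_aux {F F' : Finset ι} (T : ℕ → M →+ N)
    (hT : ∀ k m, T (k + 1) ((∏ i ∈ F, x i) • m) = (∏ i ∈ F', x i) • T k m) {m m' : M} {k k' : ℕ}
    (h : cechFrac x F m k = cechFrac x F m' k') :
    cechFrac x F' (T k m) k = cechFrac x F' (T k' m') k' := by
  have hT' : ∀ r k m, T (k + r) ((∏ i ∈ F, x i) ^ r • m) = (∏ i ∈ F', x i) ^ r • T k m := by
    intro r
    induction r with
    | zero => simp
    | succ r ih =>
      intro k m
      rw [← add_assoc, pow_succ', mul_smul, hT, ih, pow_succ', mul_smul]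
  rw [cechFrac_eq_iff] at h ⊢
  obtain ⟨u, hu⟩ := h
  refine ⟨u, ?_⟩
  rw [← hT', ← hT', hu]
  congr 2
  omega

/-- The map `m / x_F ^ k ↦ T_k(m) / x_{F'} ^ k` between localizations. -/
def fracMap (F F' : Finset ι) (T : ℕ → M →+ N)
    (hT : ∀ k m, T (k + 1) ((∏ i ∈ F, x i) • m) = (∏ i ∈ F', x i) • T k m) :
    CechLoc x M F →+ CechLoc x N F' :=
  AddMonoidHom.mk'
    (fun y => cechFrac x F' (T (exists_cechFrac x y).choose_spec.choose
      (exists_cechFrac x y).choose) (exists_cechFrac x y).choose_spec.choose)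
    (by
      have key : ∀ (y : CechLoc x M F) m k, y = cechFrac x F m k →
          cechFrac x F' (T (exists_cechFrac x y).choose_spec.choose
            (exists_cechFrac x y).choose) (exists_cechFrac x y).choose_spec.choose =
          cechFrac x F' (T k m) k := fun y m k h =>
        fracMap_aux x T hT ((exists_cechFrac x y).choose_spec.choose_spec.symm.trans h)
      intro y z
      obtain ⟨m, m', k, hy, hz⟩ := exists_cechFrac₂ x y z
      rw [key y m k hy, key z m' k hz, key (y + z) (m + m') k, cechFrac_add_cechFrac, map_add]
      rw [hy, hz, cechFrac_add_cechFrac])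

theorem fracMap_cechFrac (F F' : Finset ι) (T : ℕ → M →+ N)
    (hT : ∀ k m, T (k + 1) ((∏ i ∈ F, x i) • m) = (∏ i ∈ F', x i) • T k m) (m : M) (k : ℕ) :
    fracMap x F F' T hT (cechFrac x F m k) = cechFrac x F' (T k m) k :=
  fracMap_aux x T hT (exists_cechFrac x (cechFrac x F m k)).choose_spec.choose_spec.symm

theorem map_cechSign_smul {Y Z : Type*} [AddCommGroup Y] [Module A Y] [AddCommGroup Z] [Module A Z]
    (u : Y →+ Z) (i : ι) (G : Finset ι) (y : Y) :
    u ((cechSign i G : A) • y) = (cechSign i G : A) • u y := by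
  rcases neg_one_pow_eq_or A (G.filter (· < i)).card with h | h <;> simp [cechSign, h]

/-- Additive maps that commute with the localization maps commute with the differential. -/
theorem totD_map (u : ∀ F, CechLoc x M F →+ CechLoc x N F)
    (hu : ∀ F G (h : F ⊆ G) y, u G (cechLocMap x M h y) = cechLocMap x N h (u F y))
    (c : TotCochain x M) :
    totD x N (fun F => u F (c F)) = fun F => u F (totD x M c F) := by
  funext G
  rw [totD_apply, totD_apply, map_sum]
  refine Finset.sum_congr rfl fun i _ => ?_
  rw [map_cechSign_smul, hu]

/-- The map `M_{x_F} → N_{x_F}` induced by a linear map. -/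
def locMap (ψ : M →ₗ[A] N) (F : Finset ι) : CechLoc x M F →ₗ[A] CechLoc x N F :=
  IsLocalizedModule.map (Submonoid.powers (∏ i ∈ F, x i)) (LocalizedModule.mkLinearMap _ M)
    (LocalizedModule.mkLinearMap _ N) ψ

theorem locMap_cechFrac (ψ : M →ₗ[A] N) {F : Finset ι} (m : M) (k : ℕ) :
    locMap x ψ F (cechFrac x F m k) = cechFrac x F (ψ m) k :=
  IsLocalizedModule.map_LocalizedModules _ _ _ _

/-- The map of cochains induced by a linear map. -/
def totMap (ψ : M →ₗ[A] N) : TotCochain x M →+ TotCochain x N where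
  toFun c F := locMap x ψ F (c F)
  map_zero' := by funext F; exact map_zero _
  map_add' c c' := by funext F; exact map_add _ _ _

theorem totMap_apply (ψ : M →ₗ[A] N) (c : TotCochain x M) (F : Finset ι) :
    totMap x ψ c F = locMap x ψ F (c F) := rfl

theorem totMap_apply_of_eq_zero (ψ : M →ₗ[A] N) {c : TotCochain x M} {F : Finset ι}
    (h : c F = 0) : totMap x ψ c F = 0 := by
  rw [totMap_apply, h, map_zero]

theorem totD_totMap (ψ : M →ₗ[A] N) (c : TotCochain x M) :
    totD x N (totMap x ψ c) = totMap x ψ (totD x M c) := by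
  refine totD_map x (fun F =>
    (locMap x ψ F).toAddMonoidHom) ?_ c
  intro F G h y
  obtain ⟨m, k, rfl⟩ := exists_cechFrac x y
  change locMap x ψ G _ = cechLocMap x N h (locMap x ψ F _)
  rw [cechLocMap_cechFrac, locMap_cechFrac, locMap_cechFrac, cechLocMap_cechFrac, map_smul]

theorem resCard_totMap (ψ : M →ₗ[A] N) (t : ℕ) (c : TotCochain x M) :
    resCard x t (totMap x ψ c) = totMap x ψ (resCard x t c) := by
  funext F
  simp only [resCard, totMap_apply]
  split_ifs
  · rfl
  · rw [map_zero]

theorem totMap_exact {ψ : M →ₗ[A] N} {χ : N →ₗ[A] P} (h : Function.Exact ψ χ)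
    (c : TotCochain x N) : totMap x χ c = 0 ↔ ∃ b, totMap x ψ b = c := by
  have key := fun F : Finset ι =>
    LocalizedModule.map_exact (Submonoid.powers (∏ i ∈ F, x i)) ψ χ h
  constructor
  · intro hc
    choose b hb using fun F => (key F (c F)).mp (congrFun hc F)
    exact ⟨b, funext hb⟩
  · rintro ⟨b, rfl⟩
    funext F
    exact (key F _).mpr ⟨_, rfl⟩

theorem totMap_surjective {ψ : M →ₗ[A] N} (h : Function.Surjective ψ) :
    Function.Surjective (totMap x ψ) := by
  intro c
  choose b hb using fun F : Finset ι =>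
    (IsLocalizedModule.map_surjective (Submonoid.powers (∏ i ∈ F, x i))
      (LocalizedModule.mkLinearMap _ M) (LocalizedModule.mkLinearMap _ N) ψ h :
      Function.Surjective (locMap x ψ F)) (c F)
  exact ⟨b, funext hb⟩

end Maps

/-! ### Torsion of Čech cohomology against divisibility of cocycles. -/

section Torsion

variable {A : Type*} [CommRing A] {ι : Type*} [LinearOrder ι] (x : ι → A)
  {M : Type*} [AddCommGroup M] [Module A M]

/-- A cocycle that lives on the sets containing `l` is divisible by the powers of `x_l`. -/
theorem exists_pow_smul_eq {l : ι} {t : ℕ} {c : TotCochain x M} (hc : totD x M c = 0)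
    (ht : SuppCard x t c) (hl : ∀ F, l ∉ F → c F = 0) (k : ℕ) :
    ∃ c', totD x M c' = 0 ∧ SuppCard x t c' ∧ x l ^ k • c' = c := by
  -- Taking `y = 0` wherever `c F = 0` makes the quotient inherit both support conditions of `c`.
  have h : ∀ F, ∃ y : CechLoc x M F, x l ^ k • y = c F ∧ (c F = 0 → y = 0) := by
    intro F
    by_cases hF : c F = 0
    · exact ⟨0, by rw [smul_zero, hF], fun _ => rfl⟩
    · have hlF : l ∈ F := by
        by_contra hlF
        exact hF (hl F hlF)
      obtain ⟨y, hy⟩ := (smul_pow_bijective x M hlF k).2 (c F)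
      exact ⟨y, hy, fun h => absurd h hF⟩
  choose c' h1 h2 using h
  have h3 : x l ^ k • c' = c := funext h1
  refine ⟨c', ?_, fun F hF => h2 F (ht F hF), h3⟩
  funext G
  by_cases hG : l ∈ G
  · apply (smul_pow_bijective x M hG k).1
    have := congrFun (map_smul (totD x M) (x l ^ k) c') G
    rw [h3, hc] at this
    simpa using this.symm
  · exact totD_eq_zero_of_notMem x (fun F hF => h2 F (hl F hF)) hG

/-- The map in `hy` is localization at `x_l`, whose kernel is the `x_l`-power torsion. -/
theorem exists_pow_smul_eq_zero {l : ι} {G : Finset ι} {y : CechLoc x M G} (hl : l ∉ G)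
    (hy : cechLocMap x M (Finset.subset_insert l G) y = 0) : ∃ N, x l ^ N • y = 0 := by
  obtain ⟨m, k, rfl⟩ := exists_cechFrac x y
  rw [cechLocMap_cechFrac, ← cechFrac_zero x k, cechFrac_eq_iff] at hy
  obtain ⟨u, hu⟩ := hy
  rw [smul_zero, Finset.prod_insert hl, mul_pow, smul_smul, Finset.insert_sdiff_of_notMem _ hl,
    Finset.sdiff_self, insert_empty_eq, Finset.prod_singleton] at hu
  refine ⟨u + k + k, ?_⟩
  apply smul_pow_prod_injective x M (u + k)
  dsimp only
  rw [smul_cechFrac, smul_cechFrac, smul_smul, smul_zero]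
  rw [show (∏ i ∈ G, x i) ^ (u + k) * x l ^ (u + k + k) =
    x l ^ (u + k) * (∏ i ∈ G, x i) ^ (u + k) * x l ^ k by ring, hu, cechFrac_zero]

/-- Every cohomology class is killed by a power of `x_l`. -/
theorem exists_pow_smul_mem_range [Fintype ι] (l : ι) {c : TotCochain x M}
    (hc : totD x M c = 0) : ∃ N, x l ^ N • c ∈ LinearMap.range (totD x M) := by
  classical
  -- A contraction up to powers of `x_l`: multiplying a fraction over `(x_l x_G) ^ k` by `x_l ^ k`
  -- removes `x_l` from the denominator, so the result comes from `M_{x_G}`.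
  have hb : ∀ G : Finset ι, ∃ k, ∃ y : CechLoc x M G, l ∉ G →
      (cechSign l G : A) • cechLocMap x M (Finset.subset_insert l G) y =
        x l ^ k • c (insert l G) := by
    intro G
    obtain ⟨m, k, hm⟩ := exists_cechFrac x (c (insert l G))
    refine ⟨k, (cechSign l G : A) • cechFrac x G m k, fun hl => ?_⟩
    rw [map_smul, smul_smul, cechSign_mul_self, one_smul, hm, cechLocMap_cechFrac, smul_cechFrac,
      Finset.insert_sdiff_of_notMem _ hl, Finset.sdiff_self, insert_empty_eq,
      Finset.prod_singleton]
  choose k y hy using hb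
  obtain ⟨K, hK⟩ : ∃ K, ∀ G, k G ≤ K :=
    ⟨Finset.univ.sup k, fun G => Finset.le_sup (Finset.mem_univ G)⟩
  let b : TotCochain x M := fun G => if l ∈ G then 0 else x l ^ (K - k G) • y G
  have hb0 : ∀ G, l ∈ G → b G = 0 := fun G hG => if_pos hG
  have hb1 : ∀ G, l ∉ G → totD x M b (insert l G) = x l ^ K • c (insert l G) := by
    intro G hG
    rw [totD_insert_of_forall_mem x hb0 hG]
    simp only [b, if_neg hG]
    rw [map_smul, smul_comm, hy G hG, smul_smul, ← pow_add, Nat.sub_add_cancel (hK G)]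
  -- The error `z` is a cocycle that vanishes on all sets containing `l`. Its cocycle condition at
  -- `insert l G` then says that `z G` dies in the localization at `x_l`, so `z` is `x_l`-power
  -- torsion.
  set z := totD x M b - x l ^ K • c with hz
  have hz0 : totD x M z = 0 := by
    rw [hz, map_sub, totD_totD, map_smul, hc, smul_zero, sub_zero]
  have hz1 : ∀ G, l ∈ G → z G = 0 := by
    intro G hG
    have := hb1 (G.erase l) (Finset.notMem_erase l G)
    rw [Finset.insert_erase hG] at this
    rw [hz, Pi.sub_apply, this, Pi.smul_apply, sub_self]
  have hz2 : ∀ G, ∃ N, x l ^ N • z G = 0 := by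
    intro G
    by_cases hG : l ∈ G
    · exact ⟨0, by rw [hz1 G hG, smul_zero]⟩
    · refine exists_pow_smul_eq_zero x hG ?_
      have h := totD_insert_of_forall_mem x hz1 hG
      rw [hz0, Pi.zero_apply] at h
      have h' := congrArg (fun w => (cechSign l G : A) • w) h.symm
      rwa [smul_smul, cechSign_mul_self, one_smul, smul_zero] at h'
  choose N hN using hz2
  obtain ⟨L, hL⟩ : ∃ L, ∀ G, N G ≤ L :=
    ⟨Finset.univ.sup N, fun G => Finset.le_sup (Finset.mem_univ G)⟩
  have hL0 : x l ^ L • z = 0 := by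
    funext G
    rw [Pi.smul_apply, ← Nat.sub_add_cancel (hL G), pow_add, mul_smul, hN, smul_zero, Pi.zero_apply]
  refine ⟨L + K, x l ^ L • b, ?_⟩
  rw [map_smul, pow_add, mul_smul, ← sub_eq_zero, ← smul_sub]
  exact hL0

/-- If `H^t` is Noetherian, then a cocycle that lives on the sets containing `l` is a
coboundary. -/
theorem mem_range_of_isNoetherian [Fintype ι] {t : ℕ} [IsNoetherian A (CechCohomology x M t)]
    {l : ι} {c : TotCochain x M} (hc : totD x M c = 0) (ht : SuppCard x t c)
    (hl : ∀ F, l ∉ F → c F = 0) : c ∈ LinearMap.range (totD x M) := by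
  have h1 : ∀ z : CechCohomology x M t, ∃ N, x l ^ N • z = 0 := by
    intro z
    obtain ⟨z, rfl⟩ := Submodule.Quotient.mk_surjective _ z
    obtain ⟨N, hN⟩ := exists_pow_smul_mem_range x l ((mem_cechCocycles_iff x).mp z.2)
    refine ⟨N, ?_⟩
    rw [← Submodule.Quotient.mk_smul, cechCohomology_mk_eq_zero_iff, Submodule.coe_smul, map_smul]
    exact hN
  -- Finite generation makes the exponent uniform.
  obtain ⟨N, hN⟩ : ∃ N, ∀ z : CechCohomology x M t, x l ^ N • z = 0 := by
    obtain ⟨s, hs⟩ := Module.Finite.fg_top (R := A) (M := CechCohomology x M t)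
    choose N hN using h1
    refine ⟨s.sup N, fun z => ?_⟩
    have hz : z ∈ Submodule.span A (s : Set (CechCohomology x M t)) := hs ▸ Submodule.mem_top
    induction hz using Submodule.span_induction with
    | mem y hy =>
      rw [← Nat.sub_add_cancel (Finset.le_sup (f := N) hy), pow_add, mul_smul, hN, smul_zero]
    | zero => exact smul_zero _
    | add y y' _ _ h h' => rw [smul_add, h, h', add_zero]
    | smul a y _ h => rw [smul_comm, h, smul_zero]
  -- Now `c = x_l ^ N • c'` for a cocycle `c'`, whose class is killed by `x_l ^ N`.
  obtain ⟨c', h2, h3, h4⟩ := exists_pow_smul_eq x hc ht hl N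
  obtain ⟨z, hz⟩ := exists_cocycle x h3 h2
  have := hN (Submodule.Quotient.mk z)
  rw [← Submodule.Quotient.mk_smul, cechCohomology_mk_eq_zero_iff, Submodule.coe_smul, map_smul,
    hz, h4] at this
  exact this

end Torsion

/-! ### Multigraded projections, and division by powers of variables. -/

section Filters

/-- The exponent of the squarefree monomial `x_F`. -/
def indVec {n : ℕ} (F : Finset (Fin n)) : Fin n →₀ ℕ := ∑ i ∈ F, Finsupp.single i 1

theorem indVec_apply {n : ℕ} (F : Finset (Fin n)) (l : Fin n) :
    indVec F l = if l ∈ F then 1 else 0 := by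
  simp [indVec, Finsupp.finsetSum_apply, Finsupp.single_apply]

theorem prod_X_eq_monomial (K : Type*) [Field K] {n : ℕ} (F : Finset (Fin n)) :
    (∏ i ∈ F, X i : MvPolynomial (Fin n) K) = monomial (indVec F) 1 := by
  rw [indVec, monomial_sum_one]
  rfl

theorem prod_X_pow_eq_monomial (K : Type*) [Field K] {n : ℕ} (F : Finset (Fin n)) (k : ℕ) :
    (∏ i ∈ F, X i : MvPolynomial (Fin n) K) ^ k = monomial (k • indVec F) 1 := by
  rw [prod_X_eq_monomial, monomial_pow, one_pow]

/-- Projections of a module over `K[X_1, …, X_n]` onto the sums of its multigraded components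
whose exponents satisfy a predicate. -/
class MonomialFilter (K : Type*) [Field K] (n : ℕ) (M : Type*) [AddCommGroup M]
    [Module (MvPolynomial (Fin n) K) M] where
  /-- The projection onto the components whose exponents satisfy `p`. -/
  filt : ((Fin n →₀ ℕ) → Prop) → M →+ M
  filt_smul : ∀ p b m, filt p (monomial b (1 : K) • m) =
    monomial b (1 : K) • filt (fun a => p (a + b)) m
  filt_true : ∀ m, filt (fun _ => True) m = m
  filt_filt : ∀ p q m, filt p (filt q m) = filt (fun a => p a ∧ q a) m
  filt_or : ∀ p q m, (∀ a, ¬(p a ∧ q a)) → filt (fun a => p a ∨ q a) m = filt p m + filt q m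
  filt_bound : ∀ m, ∃ N : ℕ, filt (fun a => N ≤ a.degree) m = 0

/-- Division by powers of the variables, with the monomials that are not divisible removed. -/
class MonomialDiv (K : Type*) [Field K] (n : ℕ) (M : Type*) [AddCommGroup M]
    [Module (MvPolynomial (Fin n) K) M] [MonomialFilter K n M] where
  /-- The quotient by `X_l ^ k`. -/
  quot : Fin n → ℕ → M →+ M
  quot_zero : ∀ l m, quot l 0 m = m
  quot_X_smul : ∀ l k m, quot l (k + 1) ((X l : MvPolynomial (Fin n) K) • m) = quot l k m
  quot_smul : ∀ l k b m, b l = 0 →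
    quot l k (monomial b (1 : K) • m) = monomial b (1 : K) • quot l k m
  X_pow_smul_quot : ∀ l k m, (X l : MvPolynomial (Fin n) K) ^ k • quot l k m =
    MonomialFilter.filt K (fun a => k ≤ a l) m

open MonomialFilter MonomialDiv

variable {K : Type*} [Field K] {n : ℕ}

/-! ### Instances: projections and division for `S` and `S^b`, projections only for `S/I`. -/

section Instances

open Classical in
/-- The sum of the terms of `f` whose exponents satisfy `p`. -/
def termFilter (p : (Fin n →₀ ℕ) → Prop) :
    MvPolynomial (Fin n) K →+ MvPolynomial (Fin n) K :=
  AddMonoidHom.mk' (fun f => ∑ a ∈ f.support with p a, monomial a (coeff a f)) (by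
    have key : ∀ (f : MvPolynomial (Fin n) K) a,
        coeff a (∑ a ∈ f.support with p a, monomial a (coeff a f)) =
          if p a then coeff a f else 0 := by
      intro f a
      rw [coeff_sum]
      simp only [coeff_monomial, Finset.sum_ite_eq', Finset.mem_filter, mem_support_iff]
      by_cases h : p a <;> by_cases h' : coeff a f = 0 <;> simp [h, h']
    intro f g
    ext a
    rw [coeff_add, key, key, key, coeff_add]
    split_ifs <;> simp)

open Classical in
theorem coeff_termFilter (p : (Fin n →₀ ℕ) → Prop) (f : MvPolynomial (Fin n) K)
    (a : Fin n →₀ ℕ) : coeff a (termFilter p f) = if p a then coeff a f else 0 := by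
  change coeff a (∑ a ∈ f.support with p a, monomial a (coeff a f)) = _
  rw [coeff_sum]
  simp only [coeff_monomial, Finset.sum_ite_eq', Finset.mem_filter, mem_support_iff]
  by_cases h : p a <;> by_cases h' : coeff a f = 0 <;> simp [h, h']

theorem of_mem_support_termFilter {p : (Fin n →₀ ℕ) → Prop} {f : MvPolynomial (Fin n) K}
    {a : Fin n →₀ ℕ} (h : a ∈ (termFilter p f).support) : p a ∧ a ∈ f.support := by
  classical
  rw [mem_support_iff, coeff_termFilter] at h
  split_ifs at h with hp
  · exact ⟨hp, mem_support_iff.mpr h⟩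
  · exact absurd rfl h

theorem termFilter_monomial_mul (p : (Fin n →₀ ℕ) → Prop) (b : Fin n →₀ ℕ) (r : K)
    (f : MvPolynomial (Fin n) K) :
    termFilter p (monomial b r * f) = monomial b r * termFilter (fun a => p (a + b)) f := by
  classical
  ext a
  rw [coeff_termFilter, coeff_monomial_mul', coeff_monomial_mul', coeff_termFilter]
  by_cases h : b ≤ a
  · rw [tsub_add_cancel_of_le h]
    by_cases hp : p a <;> simp [h, hp]
  · simp [h]

theorem termFilter_mul_of_isHomogeneous {h : MvPolynomial (Fin n) K} {r : ℕ}
    (hh : h.IsHomogeneous r) (e : ℤ) (f : MvPolynomial (Fin n) K) :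
    termFilter (fun a => (a.degree : ℤ) = e + r) (h * f) =
      h * termFilter (fun a => (a.degree : ℤ) = e) f := by
  conv_lhs => rw [h.as_sum]
  conv_rhs => rw [h.as_sum]
  rw [Finset.sum_mul, Finset.sum_mul, map_sum]
  refine Finset.sum_congr rfl fun b hb => ?_
  have hb' : b.degree = r := by
    rw [Finsupp.degree_eq_weight_one]
    exact hh (mem_support_iff.mp hb)
  rw [termFilter_monomial_mul]
  congr 3
  funext a
  rw [map_add, Nat.cast_add, hb', add_left_inj]

instance : MonomialFilter K n (MvPolynomial (Fin n) K) where
  filt := termFilter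
  filt_smul p b f := termFilter_monomial_mul p b 1 f
  filt_true f := by
    ext a
    simp [coeff_termFilter]
  filt_filt p q f := by
    ext a
    simp only [coeff_termFilter]
    by_cases h : p a <;> by_cases h' : q a <;> simp [h, h']
  filt_or p q f hpq := by
    ext a
    simp only [coeff_add, coeff_termFilter]
    have := hpq a
    by_cases h : p a <;> by_cases h' : q a <;> simp_all
  filt_bound f := by
    refine ⟨f.support.sup Finsupp.degree + 1, ?_⟩
    ext a
    rw [coeff_termFilter, coeff_zero]
    split_ifs with h
    · by_contra h'
      have := Finset.le_sup (f := Finsupp.degree) (mem_support_iff.mpr h')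
      omega
    · rfl

theorem filt_eq_termFilter (p : (Fin n →₀ ℕ) → Prop) (f : MvPolynomial (Fin n) K) :
    filt K p f = termFilter p f := rfl

instance : MonomialDiv K n (MvPolynomial (Fin n) K) where
  quot l k := AddMonoidHom.mk' (fun f => f.divMonomial (Finsupp.single l k))
    fun f g => add_divMonomial f g _
  quot_zero l f := by
    simp [divMonomial_zero]
  quot_X_smul l k f := by
    ext a
    simp only [AddMonoidHom.mk'_apply, coeff_divMonomial, smul_eq_mul]
    rw [show Finsupp.single l (k + 1) + a = Finsupp.single l 1 + (Finsupp.single l k + a) by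
      rw [← add_assoc, ← Finsupp.single_add, add_comm 1 k], coeff_X_mul]
  quot_smul l k b f hb := by
    ext a
    simp only [AddMonoidHom.mk'_apply, coeff_divMonomial, smul_eq_mul, coeff_monomial_mul',
      one_mul]
    have h : b ≤ Finsupp.single l k + a ↔ b ≤ a := by
      simp only [Finsupp.le_def, Finsupp.add_apply]
      refine forall_congr' fun i => ?_
      by_cases hi : i = l
      · simp [hi, hb]
      · simp [Ne.symm hi]
    by_cases hba : b ≤ a
    · rw [if_pos hba, if_pos (h.mpr hba), add_tsub_assoc_of_le hba]
    · rw [if_neg hba, if_neg (mt h.mp hba)]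
  X_pow_smul_quot l k f := by
    classical
    ext a
    rw [filt_eq_termFilter, coeff_termFilter, smul_eq_mul, X_pow_eq_monomial, coeff_monomial_mul',
      AddMonoidHom.mk'_apply, coeff_divMonomial]
    simp only [Finsupp.single_le_iff, one_mul]
    split_ifs with h
    · rw [add_tsub_cancel_of_le (Finsupp.single_le_iff.mpr h)]
    · rfl

instance {b : ℕ} : MonomialFilter K n (Fin b → MvPolynomial (Fin n) K) where
  filt p := AddMonoidHom.mk' (fun v i => termFilter p (v i)) fun v w => by
    funext i
    simp
  filt_smul p b v := by
    funext i
    exact filt_smul (K := K) p b (v i)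
  filt_true v := by
    funext i
    exact filt_true (K := K) (n := n) (v i)
  filt_filt p q v := by
    funext i
    exact filt_filt (K := K) (n := n) p q (v i)
  filt_or p q v h := by
    funext i
    exact filt_or (K := K) (n := n) p q (v i) h
  filt_bound v := by
    choose N hN using fun i => filt_bound (K := K) (n := n) (v i)
    refine ⟨Finset.univ.sup N, funext fun i => ?_⟩
    have h : (fun a : Fin n →₀ ℕ => Finset.univ.sup N ≤ a.degree) =
        fun a => Finset.univ.sup N ≤ a.degree ∧ N i ≤ a.degree := by
      funext a
      have := Finset.le_sup (f := N) (Finset.mem_univ i)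
      exact propext ⟨fun h => ⟨h, this.trans h⟩, fun h => h.1⟩
    change termFilter _ (v i) = 0
    rw [h, ← filt_eq_termFilter, ← filt_filt, hN, map_zero]

theorem filt_pi_apply {b : ℕ} (p : (Fin n →₀ ℕ) → Prop) (v : Fin b → MvPolynomial (Fin n) K)
    (i : Fin b) : filt K p v i = termFilter p (v i) := rfl

instance {b : ℕ} : MonomialDiv K n (Fin b → MvPolynomial (Fin n) K) where
  quot l k := AddMonoidHom.mk' (fun v i => quot K l k (v i)) fun v w => by
    funext i
    simp
  quot_zero l v := by
    funext i
    exact quot_zero (K := K) l (v i)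
  quot_X_smul l k v := by
    funext i
    exact quot_X_smul (K := K) l k (v i)
  quot_smul l k b v hb := by
    funext i
    exact quot_smul (K := K) l k b (v i) hb
  X_pow_smul_quot l k v := by
    funext i
    exact X_pow_smul_quot (K := K) l k (v i)

/-- Membership in a monomial ideal is tested on each exponent of the support separately. This is
what lets arbitrary exponent projections descend to `S/I`. -/
theorem IsMonomialIdeal.termFilter_mem {I : Ideal (MvPolynomial (Fin n) K)}
    (hI : IsMonomialIdeal I) (p : (Fin n →₀ ℕ) → Prop) {f : MvPolynomial (Fin n) K} (hf : f ∈ I) :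
    termFilter p f ∈ I := by
  obtain ⟨E, rfl⟩ := hI
  rw [mem_ideal_span_monomial_image] at hf ⊢
  exact fun a ha => hf a (of_mem_support_termFilter ha).2

/-- The projections of the quotient by a monomial ideal. -/
def quotientFilter (I : Ideal (MvPolynomial (Fin n) K)) [hI : Fact (IsMonomialIdeal I)]
    (p : (Fin n →₀ ℕ) → Prop) :
    MvPolynomial (Fin n) K ⧸ I →+ MvPolynomial (Fin n) K ⧸ I :=
  QuotientAddGroup.map I.toAddSubgroup I.toAddSubgroup (termFilter p)
    fun _ hf => hI.out.termFilter_mem p hf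

theorem quotientFilter_mk (I : Ideal (MvPolynomial (Fin n) K)) [Fact (IsMonomialIdeal I)]
    (p : (Fin n →₀ ℕ) → Prop) (f : MvPolynomial (Fin n) K) :
    quotientFilter I p (Ideal.Quotient.mk I f) = Ideal.Quotient.mk I (termFilter p f) := rfl

theorem smul_quotient_mk (I : Ideal (MvPolynomial (Fin n) K)) (f g : MvPolynomial (Fin n) K) :
    f • Ideal.Quotient.mk I g = Ideal.Quotient.mk I (f • g) := rfl

instance (I : Ideal (MvPolynomial (Fin n) K)) [Fact (IsMonomialIdeal I)] :
    MonomialFilter K n (MvPolynomial (Fin n) K ⧸ I) where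
  filt := quotientFilter I
  filt_smul p b m := by
    obtain ⟨f, rfl⟩ := Ideal.Quotient.mk_surjective m
    rw [smul_quotient_mk, quotientFilter_mk, quotientFilter_mk, smul_quotient_mk,
      ← filt_eq_termFilter, filt_smul, filt_eq_termFilter]
  filt_true m := by
    obtain ⟨f, rfl⟩ := Ideal.Quotient.mk_surjective m
    rw [quotientFilter_mk, ← filt_eq_termFilter, filt_true]
  filt_filt p q m := by
    obtain ⟨f, rfl⟩ := Ideal.Quotient.mk_surjective m
    simp only [quotientFilter_mk, ← filt_eq_termFilter, filt_filt]
  filt_or p q m h := by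
    obtain ⟨f, rfl⟩ := Ideal.Quotient.mk_surjective m
    simp only [quotientFilter_mk, ← filt_eq_termFilter, filt_or _ _ _ h, map_add]
  filt_bound m := by
    obtain ⟨f, rfl⟩ := Ideal.Quotient.mk_surjective m
    obtain ⟨N, hN⟩ := filt_bound (K := K) (n := n) f
    exact ⟨N, by rw [quotientFilter_mk, ← filt_eq_termFilter, hN, map_zero]⟩

theorem filt_mk (I : Ideal (MvPolynomial (Fin n) K)) [Fact (IsMonomialIdeal I)]
    (p : (Fin n →₀ ℕ) → Prop) (f : MvPolynomial (Fin n) K) :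
    filt K p (Ideal.Quotient.mk I f) = Ideal.Quotient.mk I (termFilter p f) := rfl

end Instances

/-! ### Multigraded parts of localizations and of cochains. -/

section Parts

variable {M N : Type*} [AddCommGroup M] [Module (MvPolynomial (Fin n) K) M] [MonomialFilter K n M]
  [AddCommGroup N] [Module (MvPolynomial (Fin n) K) N] [MonomialFilter K n N]

/-- The predicate on exponents of numerators over `x_F ^ k` that corresponds to a predicate on
the degrees of fractions. -/
def shiftPred (A : (Fin n → ℤ) → Prop) (F : Finset (Fin n)) (k : ℕ) (a : Fin n →₀ ℕ) : Prop :=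
  A fun l => (a l : ℤ) - k * indVec F l

theorem filt_false (m : M) : filt K (fun _ : Fin n →₀ ℕ => False) m = 0 := by
  have := filt_or (K := K) (n := n) (fun _ => False) (fun _ => False) m (by simp)
  simpa using this

variable (K M) in
/-- The projection of `M_{x_F}` onto the components whose degrees satisfy `A`. -/
def locPart (A : (Fin n → ℤ) → Prop) (F : Finset (Fin n)) :
    CechLoc (X : Fin n → MvPolynomial (Fin n) K) M F →+
      CechLoc (X : Fin n → MvPolynomial (Fin n) K) M F :=
  fracMap X F F (fun k => filt K (shiftPred A F k)) (by
    intro k m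
    rw [prod_X_eq_monomial, filt_smul]
    congr 3
    funext a
    simp only [shiftPred, Finsupp.add_apply]
    congr 1
    funext l
    push_cast
    ring)

theorem locPart_cechFrac (A : (Fin n → ℤ) → Prop) (F : Finset (Fin n)) (m : M) (k : ℕ) :
    locPart K M A F (cechFrac X F m k) = cechFrac X F (filt K (shiftPred A F k) m) k :=
  fracMap_cechFrac _ _ _ _ _ _ _

/-- The denominator `x_F ^ k` shifts only the coordinates in `F`, so degrees occurring in `M_{x_F}`
are nonnegative off `F`. The vanishing of parts on suitable `F` rests on this. -/
theorem locPart_congr {A B : (Fin n → ℤ) → Prop} {F : Finset (Fin n)}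
    (h : ∀ v, (∀ l, l ∉ F → 0 ≤ v l) → (A v ↔ B v))
    (y : CechLoc (X : Fin n → MvPolynomial (Fin n) K) M F) :
    locPart K M A F y = locPart K M B F y := by
  obtain ⟨m, k, rfl⟩ := exists_cechFrac _ y
  rw [locPart_cechFrac, locPart_cechFrac]
  congr 3
  funext a
  refine propext (h _ fun l hl => ?_)
  simp [indVec_apply, hl]

theorem locPart_eq_self {A : (Fin n → ℤ) → Prop} {F : Finset (Fin n)}
    (h : ∀ v, (∀ l, l ∉ F → 0 ≤ v l) → A v)
    (y : CechLoc (X : Fin n → MvPolynomial (Fin n) K) M F) : locPart K M A F y = y := by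
  rw [locPart_congr (B := fun _ => True) fun v hv => iff_true_intro (h v hv)]
  obtain ⟨m, k, rfl⟩ := exists_cechFrac _ y
  rw [locPart_cechFrac]
  exact congrArg (fun m => cechFrac X F m k) (filt_true m)

theorem locPart_eq_zero {A : (Fin n → ℤ) → Prop} {F : Finset (Fin n)}
    (h : ∀ v, (∀ l, l ∉ F → 0 ≤ v l) → ¬ A v)
    (y : CechLoc (X : Fin n → MvPolynomial (Fin n) K) M F) : locPart K M A F y = 0 := by
  rw [locPart_congr (B := fun _ => False) fun v hv => iff_false_intro (h v hv)]
  obtain ⟨m, k, rfl⟩ := exists_cechFrac _ y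
  rw [locPart_cechFrac]
  exact (congrArg (fun m => cechFrac X F m k) (filt_false m)).trans (cechFrac_zero _ _)

theorem locPart_locPart (A B : (Fin n → ℤ) → Prop) (F : Finset (Fin n))
    (y : CechLoc (X : Fin n → MvPolynomial (Fin n) K) M F) :
    locPart K M A F (locPart K M B F y) = locPart K M (fun v => A v ∧ B v) F y := by
  obtain ⟨m, k, rfl⟩ := exists_cechFrac _ y
  rw [locPart_cechFrac, locPart_cechFrac, locPart_cechFrac, filt_filt]
  rfl

theorem locPart_or {A B : (Fin n → ℤ) → Prop} (h : ∀ v, ¬(A v ∧ B v)) (F : Finset (Fin n))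
    (y : CechLoc (X : Fin n → MvPolynomial (Fin n) K) M F) :
    locPart K M (fun v => A v ∨ B v) F y = locPart K M A F y + locPart K M B F y := by
  obtain ⟨m, k, rfl⟩ := exists_cechFrac _ y
  rw [locPart_cechFrac, locPart_cechFrac, locPart_cechFrac, cechFrac_add_cechFrac,
    ← filt_or (shiftPred A F k) (shiftPred B F k) m fun a => h _]
  rfl

theorem sum_indVec (F : Finset (Fin n)) : ∑ l, (indVec F l : ℤ) = F.card := by
  simp [indVec_apply]

theorem sum_shift (a : Fin n →₀ ℕ) (F : Finset (Fin n)) (k : ℕ) :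
    ∑ l, ((a l : ℤ) - k * indVec F l) = a.degree - k * F.card := by
  rw [Finset.sum_sub_distrib, ← Finset.mul_sum, sum_indVec, Finsupp.degree_eq_sum]
  push_cast
  rfl

/-- A degree bound for the numerator suffices, since denominators only lower the degree. -/
theorem exists_locPart_eq_zero {F : Finset (Fin n)}
    (y : CechLoc (X : Fin n → MvPolynomial (Fin n) K) M F) :
    ∃ N : ℕ, ∀ A : (Fin n → ℤ) → Prop, (∀ v, A v → (N : ℤ) ≤ ∑ l, v l) →
      locPart K M A F y = 0 := by
  obtain ⟨m, k, rfl⟩ := exists_cechFrac _ y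
  obtain ⟨N, hN⟩ := filt_bound (K := K) (n := n) m
  refine ⟨N, fun A hA => ?_⟩
  have h : shiftPred A F k = fun a => shiftPred A F k a ∧ N ≤ a.degree := by
    funext a
    refine propext ⟨fun h => ⟨h, ?_⟩, fun h => h.1⟩
    have := hA _ h
    rw [sum_shift] at this
    have h2 : (0 : ℤ) ≤ k * F.card := by positivity
    omega
  rw [locPart_cechFrac, h, ← filt_filt, hN, map_zero, cechFrac_zero]

theorem locPart_cechLocMap (A : (Fin n → ℤ) → Prop) {F G : Finset (Fin n)} (h : F ⊆ G)
    (y : CechLoc (X : Fin n → MvPolynomial (Fin n) K) M F) :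
    locPart K M A G (cechLocMap X M h y) = cechLocMap X M h (locPart K M A F y) := by
  obtain ⟨m, k, rfl⟩ := exists_cechFrac _ y
  rw [cechLocMap_cechFrac, locPart_cechFrac, locPart_cechFrac, cechLocMap_cechFrac,
    prod_X_pow_eq_monomial, filt_smul]
  congr 4
  funext a
  simp only [shiftPred, Finsupp.add_apply]
  congr 1
  funext l
  by_cases hF : l ∈ F
  · simp [indVec_apply, hF, h hF]
  · by_cases hG : l ∈ G <;> simp [indVec_apply, hF, hG]

/-- The projection of cochains onto the components whose degrees satisfy `A`. -/
def totPart (A : (Fin n → ℤ) → Prop) (c : TotCochain (X : Fin n → MvPolynomial (Fin n) K) M) :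
    TotCochain (X : Fin n → MvPolynomial (Fin n) K) M :=
  fun F => locPart K M A F (c F)

theorem totPart_apply (A : (Fin n → ℤ) → Prop)
    (c : TotCochain (X : Fin n → MvPolynomial (Fin n) K) M) (F : Finset (Fin n)) :
    totPart A c F = locPart K M A F (c F) := rfl

theorem totD_totPart (A : (Fin n → ℤ) → Prop)
    (c : TotCochain (X : Fin n → MvPolynomial (Fin n) K) M) :
    totD X M (totPart A c) = totPart A (totD X M c) :=
  totD_map X (fun F => locPart K M A F) (fun _ _ h y => locPart_cechLocMap A h y) c

theorem totPart_zero (A : (Fin n → ℤ) → Prop) :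
    totPart A (0 : TotCochain (X : Fin n → MvPolynomial (Fin n) K) M) = 0 :=
  funext fun _ => map_zero _

theorem suppCard_totPart {t : ℕ} {c : TotCochain (X : Fin n → MvPolynomial (Fin n) K) M}
    (hc : SuppCard X t c) (A : (Fin n → ℤ) → Prop) : SuppCard X t (totPart A c) := by
  intro F hF
  rw [totPart_apply, hc F hF, map_zero]

theorem totPart_totPart (A B : (Fin n → ℤ) → Prop)
    (c : TotCochain (X : Fin n → MvPolynomial (Fin n) K) M) :
    totPart A (totPart B c) = totPart (fun v => A v ∧ B v) c :=
  funext fun F => by rw [totPart_apply, totPart_apply, locPart_locPart, totPart_apply]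

theorem totPart_or {A B : (Fin n → ℤ) → Prop} (h : ∀ v, ¬(A v ∧ B v))
    (c : TotCochain (X : Fin n → MvPolynomial (Fin n) K) M) :
    totPart (fun v => A v ∨ B v) c = totPart A c + totPart B c :=
  funext fun F => by
    rw [totPart_apply, locPart_or h, Pi.add_apply, totPart_apply, totPart_apply]

theorem totPart_true (c : TotCochain (X : Fin n → MvPolynomial (Fin n) K) M) :
    totPart (fun _ => True) c = c :=
  funext fun F => by rw [totPart_apply, locPart_eq_self fun _ _ => trivial]

/-- The predicate of having total degree `j`. -/
def degEq (j : ℤ) (v : Fin n → ℤ) : Prop := ∑ l, v l = j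

/-- A linear map that shifts total degrees by `r` does so on cochains. -/
theorem totPart_totMap {ψ : M →ₗ[MvPolynomial (Fin n) K] N} {r : ℤ}
    (hψ : ∀ (e : ℤ) m, filt K (fun a : Fin n →₀ ℕ => (a.degree : ℤ) = e + r) (ψ m) =
      ψ (filt K (fun a : Fin n →₀ ℕ => (a.degree : ℤ) = e) m)) (j : ℤ)
    (c : TotCochain (X : Fin n → MvPolynomial (Fin n) K) M) :
    totPart (degEq (j + r)) (totMap X ψ c) = totMap X ψ (totPart (degEq j) c) := by
  funext F
  rw [totPart_apply, totMap_apply, totMap_apply, totPart_apply]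
  obtain ⟨m, k, hm⟩ := exists_cechFrac _ (c F)
  have key : ∀ e, shiftPred (degEq e) F k = fun a => (a.degree : ℤ) = e + k * F.card := by
    intro e
    funext a
    rw [shiftPred, degEq, sum_shift, sub_eq_iff_eq_add]
  rw [hm, locMap_cechFrac, locPart_cechFrac, locPart_cechFrac, locMap_cechFrac, key, key, ← hψ]
  congr 4
  funext a
  rw [add_right_comm]

end Parts

end Filters

/-! ### Vanishing of multigraded parts of cohomology. -/

section Vanishing

open MonomialFilter MonomialDiv

variable {K : Type*} [Field K] {n : ℕ}

section Free

variable {M : Type*} [AddCommGroup M] [Module (MvPolynomial (Fin n) K) M] [MonomialFilter K n M]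

/-- The variables are treated one at a time: each truncation of a cocycle is again a cocycle, so `h`
applies to it. The lemma serves free modules with `Q` negativity and `S/I` with `Q` nonnegativity.
-/
theorem sub_totPart_mem_range {t : ℕ} (Q : ℤ → Prop)
    (h : ∀ l, ∀ c : TotCochain (X : Fin n → MvPolynomial (Fin n) K) M, totD X M c = 0 →
      SuppCard X t c → totPart (fun v => ¬ Q (v l)) c ∈ LinearMap.range (totD X M))
    {c : TotCochain (X : Fin n → MvPolynomial (Fin n) K) M} (hc : totD X M c = 0)
    (ht : SuppCard X t c) : c - totPart (fun v => ∀ l, Q (v l)) c ∈ LinearMap.range (totD X M) := by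
  have key : ∀ s : Finset (Fin n),
      c - totPart (fun v => ∀ l ∈ s, Q (v l)) c ∈ LinearMap.range (totD X M) := by
    intro s
    induction s using Finset.induction_on with
    | empty =>
      have e : (fun v : Fin n → ℤ => ∀ l ∈ (∅ : Finset (Fin n)), Q (v l)) = fun _ => True := by
        funext v
        simp
      rw [e, totPart_true, sub_self]
      exact zero_mem _
    | insert l s hl ih =>
      set c' := totPart (fun v => ∀ l ∈ s, Q (v l)) c with hc'
      have h1 := h l c' (by rw [hc', totD_totPart, hc, totPart_zero]) (suppCard_totPart ht _)
      have e : totPart (fun v => ∀ m ∈ insert l s, Q (v m)) c = totPart (fun v => Q (v l)) c' := by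
        rw [hc', totPart_totPart]
        congr 1
        funext v
        simp
      have h2 : c' = totPart (fun v => Q (v l)) c' + totPart (fun v => ¬ Q (v l)) c' := by
        rw [← totPart_or (A := fun v => Q (v l)) (B := fun v => ¬ Q (v l)) fun v h => h.2 h.1]
        conv_lhs => rw [← totPart_true c']
        congr 1
        funext v
        exact propext (iff_of_true trivial (em _))
      rw [e]
      have h3 := add_mem ih h1
      convert h3 using 1
      rw [sub_add_eq_add_sub, eq_comm, sub_eq_sub_iff_add_eq_add]
      conv_rhs => rw [h2]
      abel
  simpa using key Finset.univ

variable [MonomialDiv K n M]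

variable (K M) in
/-- Division by `X_l ^ k` on fractions over `(X_l x_F) ^ k`. -/
def quotLoc (l : Fin n) (F : Finset (Fin n)) (hl : l ∉ F) :
    CechLoc (X : Fin n → MvPolynomial (Fin n) K) M (insert l F) →+
      CechLoc (X : Fin n → MvPolynomial (Fin n) K) M F :=
  fracMap X (insert l F) F (quot K l) (by
    intro k m
    rw [Finset.prod_insert hl, mul_smul, quot_X_smul, prod_X_eq_monomial,
      quot_smul _ _ _ _ (by simp [indVec_apply, hl])])

theorem quotLoc_cechFrac {l : Fin n} {F : Finset (Fin n)} (hl : l ∉ F) (m : M) (k : ℕ) :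
    quotLoc K M l F hl (cechFrac X (insert l F) m k) = cechFrac X F (quot K l k m) k :=
  fracMap_cechFrac _ _ _ _ _ _ _

/-- Division by `X_l ^ k` discards the numerators not divisible by it, which are exactly the
fractions of negative degree in `l`. So `quotLoc` inverts the localization map on the part with `v_l
≥ 0`. -/
theorem cechLocMap_quotLoc {l : Fin n} {F : Finset (Fin n)} (hl : l ∉ F)
    (y : CechLoc (X : Fin n → MvPolynomial (Fin n) K) M (insert l F)) :
    cechLocMap X M (Finset.subset_insert l F) (quotLoc K M l F hl y) =
      locPart K M (fun v => 0 ≤ v l) (insert l F) y := by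
  obtain ⟨m, k, rfl⟩ := exists_cechFrac _ y
  rw [quotLoc_cechFrac, cechLocMap_cechFrac, locPart_cechFrac,
    Finset.insert_sdiff_of_notMem _ hl, Finset.sdiff_self, insert_empty_eq,
    Finset.prod_singleton, X_pow_smul_quot]
  congr 3
  funext a
  simp [shiftPred, indVec_apply]

theorem quot_X_pow_smul (l : Fin n) (k : ℕ) (m : M) :
    quot K l k ((X l : MvPolynomial (Fin n) K) ^ k • m) = m := by
  induction k with
  | zero => rw [pow_zero, one_smul, quot_zero]
  | succ k ih => rw [pow_succ', mul_smul, quot_X_smul, ih]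

theorem quotLoc_cechLocMap {l : Fin n} {F : Finset (Fin n)} (hl : l ∉ F)
    (y : CechLoc (X : Fin n → MvPolynomial (Fin n) K) M F) :
    quotLoc K M l F hl (cechLocMap X M (Finset.subset_insert l F) y) = y := by
  obtain ⟨m, k, rfl⟩ := exists_cechFrac _ y
  rw [cechLocMap_cechFrac, quotLoc_cechFrac, Finset.insert_sdiff_of_notMem _ hl,
    Finset.sdiff_self, insert_empty_eq, Finset.prod_singleton, quot_X_pow_smul]

theorem quotLoc_cechLocMap_insert {l : Fin n} {F G : Finset (Fin n)} (hF : l ∉ F) (hG : l ∉ G)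
    (h : F ⊆ G) (y : CechLoc (X : Fin n → MvPolynomial (Fin n) K) M (insert l F)) :
    quotLoc K M l G hG (cechLocMap X M (Finset.insert_subset_insert l h) y) =
      cechLocMap X M h (quotLoc K M l F hF y) := by
  obtain ⟨m, k, rfl⟩ := exists_cechFrac _ y
  have e : insert l G \ insert l F = G \ F := by
    ext a
    by_cases ha : a = l
    · simp [ha, hG]
    · simp [ha]
  rw [cechLocMap_cechFrac, quotLoc_cechFrac, quotLoc_cechFrac, cechLocMap_cechFrac,
    prod_X_pow_eq_monomial, prod_X_pow_eq_monomial, quot_smul _ _ _ _ (by simp [indVec_apply])]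
  rw [e]

-- The contracting homotopy is `b F = ± quotLoc (c (insert l F))` for `l ∉ F`, and zero on the other
-- sets. On sets containing `l` only one term of its differential survives, and it is the
-- nonnegative part of `c`.
open Classical in
theorem totPart_nonneg_mem_range (l : Fin n)
    {c : TotCochain (X : Fin n → MvPolynomial (Fin n) K) M} (hc : totD X M c = 0) :
    totPart (fun v => 0 ≤ v l) c ∈ LinearMap.range (totD X M) := by
  let b : TotCochain (X : Fin n → MvPolynomial (Fin n) K) M := fun F =>
    if hl : l ∉ F then (cechSign l F : MvPolynomial (Fin n) K) •
      quotLoc K M l F hl (c (insert l F)) else 0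
  have hb0 : ∀ F, l ∈ F → b F = 0 := fun F hF => dif_neg (not_not.mpr hF)
  have hb1 : ∀ F (hl : l ∉ F), b F = (cechSign l F : MvPolynomial (Fin n) K) •
      quotLoc K M l F hl (c (insert l F)) := fun F hF => dif_pos hF
  refine ⟨b, ?_⟩
  funext G
  by_cases hG : l ∈ G
  · obtain ⟨G, hl, rfl⟩ : ∃ G', l ∉ G' ∧ insert l G' = G :=
      ⟨G.erase l, Finset.notMem_erase l G, Finset.insert_erase hG⟩
    rw [totD_insert_of_forall_mem X hb0 hl, hb1 G hl, map_smul, smul_smul, cechSign_mul_self,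
      one_smul, cechLocMap_quotLoc, totPart_apply]
  · rw [totPart_apply, locPart_eq_self fun v hv => hv l hG]
    -- For `l ∉ G` all of `c G` is nonnegative in `l`. Applying `quotLoc` to the cocycle condition
    -- at `insert l G` expresses `c G` by the values of `c` on the sets `insert l (G.erase i)`, that
    -- is, by `b`.
    have h := congrArg (quotLoc K M l G hG) (congrFun hc (insert l G))
    rw [Pi.zero_apply, map_zero, totD_apply, Finset.sum_insert hG, map_add, map_sum,
      map_cechSign_smul,
      cechLocMap_congr X c _ (Finset.subset_insert l G) (Finset.erase_insert hG),
      quotLoc_cechLocMap] at h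
    have h' := congrArg
      (fun w => (cechSign l (insert l G) : MvPolynomial (Fin n) K) • w) h
    rw [smul_add, smul_smul, cechSign_mul_self, one_smul, smul_zero, add_eq_zero_iff_eq_neg,
      Finset.smul_sum, ← Finset.sum_neg_distrib] at h'
    rw [h', totD_apply]
    refine Finset.sum_congr rfl fun i hi => ?_
    have hil : l ≠ i := fun h => hG (h ▸ hi)
    have hlG : l ∉ G.erase i := fun h => hG (Finset.mem_of_mem_erase h)
    rw [hb1 _ hlG, map_smul, map_cechSign_smul, cechLocMap_congr X c _
      (Finset.insert_subset_insert l (G.erase_subset i)) (Finset.erase_insert_of_ne hil),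
      quotLoc_cechLocMap_insert hlG hG (G.erase_subset i), smul_smul, smul_smul, ← neg_smul]
    congr 1
    obtain ⟨G, hiG, rfl⟩ : ∃ G', i ∉ G' ∧ insert i G' = G :=
      ⟨G.erase i, Finset.notMem_erase i G, Finset.insert_erase hi⟩
    rw [Finset.erase_insert hiG] at hlG ⊢
    have h1 := cechSign_swap (A := MvPolynomial (Fin n) K) hlG hiG hil
    have h2 := cechSign_mul_self (A := MvPolynomial (Fin n) K) l (insert i G)
    have h3 := cechSign_mul_self (A := MvPolynomial (Fin n) K) l G
    rw [Finset.insert_comm, cechSign_insert_self, cechSign_insert_self, Finset.insert_comm,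
      cechSign_insert_self]
    linear_combination (cechSign l (insert i G) * cechSign l G : MvPolynomial (Fin n) K) * h1 -
      (cechSign i G * cechSign l G : MvPolynomial (Fin n) K) * h2 -
      (cechSign l (insert i G) * cechSign i (insert l G) : MvPolynomial (Fin n) K) * h3

/-- By the contraction in each variable, the cohomology of a free module lives in degrees all of
whose coordinates are negative. -/
theorem mem_range_of_totPart_neg_eq_zero {t : ℕ}
    {c : TotCochain (X : Fin n → MvPolynomial (Fin n) K) M} (hc : totD X M c = 0)
    (ht : SuppCard X t c) (h : totPart (fun v => ∀ l, v l < 0) c = 0) :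
    c ∈ LinearMap.range (totD X M) := by
  have := sub_totPart_mem_range (t := t) (· < 0) (fun l c hc _ => by
    simpa only [not_lt] using totPart_nonneg_mem_range l hc) hc ht
  rwa [h, sub_zero] at this

/-- The Čech cohomology of a free module vanishes below degree `n`. -/
theorem mem_range_of_lt {t : ℕ} (htn : t < n)
    {c : TotCochain (X : Fin n → MvPolynomial (Fin n) K) M} (hc : totD X M c = 0)
    (ht : SuppCard X t c) : c ∈ LinearMap.range (totD X M) := by
  refine mem_range_of_totPart_neg_eq_zero hc ht ?_
  funext F
  rw [totPart_apply, Pi.zero_apply]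
  by_cases hF : F.card = t
  -- A set of fewer than `n` elements misses some `l`, and there degrees cannot be negative.
  · obtain ⟨l, hl⟩ : ∃ l, l ∉ F := by
      by_contra! h
      have := Finset.eq_univ_iff_forall.mpr h
      rw [this, Finset.card_univ, Fintype.card_fin] at hF
      omega
    exact locPart_eq_zero (fun v hv h => absurd (h l) (not_lt.mpr (hv l hl))) _
  · rw [ht F hF, map_zero]

/-- The top Čech cohomology of a free module vanishes in degrees greater than `-n`. -/
theorem mem_range_of_degEq {e : ℤ} (he : -(n : ℤ) < e)
    {c : TotCochain (X : Fin n → MvPolynomial (Fin n) K) M} (ht : SuppCard X n c)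
    (hdeg : totPart (degEq e) c = c) : c ∈ LinearMap.range (totD X M) := by
  have hc : totD X M c = 0 := by
    funext G
    refine ht.totD G ?_
    have := G.card_le_univ
    rw [Fintype.card_fin] at this
    omega
  refine mem_range_of_totPart_neg_eq_zero hc ht ?_
  rw [← hdeg, totPart_totPart]
  funext F
  refine locPart_eq_zero ?_ (c F)
  rintro v - ⟨h1, h2⟩
  -- All `n` coordinates are at most `-1`, so the total degree is at most `-n`.
  have : ∑ l, v l ≤ ∑ _l : Fin n, (-1 : ℤ) := Finset.sum_le_sum fun l _ => by
    have := h1 l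
    omega
  rw [degEq] at h2
  simp at this
  omega

end Free

section Quotient

variable {I : Ideal (MvPolynomial (Fin n) K)} [Fact (IsMonomialIdeal I)]

theorem locPart_mem_locDegreePart (F : Finset (Fin n)) (j : ℤ)
    (y : CechLoc (X : Fin n → MvPolynomial (Fin n) K) (MvPolynomial (Fin n) K ⧸ I) F) :
    locPart K _ (degEq j) F y ∈ locDegreePart I F j := by
  obtain ⟨m, k, rfl⟩ := exists_cechFrac _ y
  obtain ⟨f, rfl⟩ := Ideal.Quotient.mk_surjective m
  rw [locPart_cechFrac, filt_mk]
  refine ⟨k, _, fun a ha => ?_, rfl⟩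
  have := (of_mem_support_termFilter ha).1
  rw [shiftPred, degEq, sum_shift] at this
  omega

theorem locPart_eq_self_of_mem {F : Finset (Fin n)} {j : ℤ}
    {y : CechLoc (X : Fin n → MvPolynomial (Fin n) K) (MvPolynomial (Fin n) K ⧸ I) F}
    (hy : y ∈ locDegreePart I F j) : locPart K _ (degEq j) F y = y := by
  obtain ⟨k, f, hf, rfl⟩ := hy
  rw [locPart_cechFrac, filt_mk]
  congr 2
  ext a
  rw [coeff_termFilter]
  split_ifs with h
  · rfl
  · by_contra h'
    have := hf a (mem_support_iff.mpr (Ne.symm h'))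
    rw [shiftPred, degEq, sum_shift] at h
    omega

/-- If `H^i` is Noetherian and vanishes in all degrees `j ≥ 0`, then it vanishes. -/
theorem subsingleton_localCoh {i : ℕ} [IsNoetherian (MvPolynomial (Fin n) K) (LocalCoh I i)]
    (h : ∀ j : ℤ, 0 ≤ j → localCohDegreePart I i j = ⊥) : Subsingleton (LocalCoh I i) := by
  refine subsingleton_of_forall_eq 0 fun z => ?_
  obtain ⟨z, rfl⟩ := Submodule.Quotient.mk_surjective _ z
  rw [cechCohomology_mk_eq_zero_iff]
  have hc := (mem_cechCocycles_iff _).mp z.2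
  have ht := suppCard_extCochain (X : Fin n → MvPolynomial (Fin n) K) z.1
  set c := extCochain X i z.1
  -- The part with `v_l < 0` vanishes on every `F` not containing `l`, so it is a coboundary by the
  -- Noetherian hypothesis.
  have h1 := sub_totPart_mem_range (t := i) (0 ≤ ·) (fun l c hc ht =>
    mem_range_of_isNoetherian X (t := i) (l := l) (by rw [totD_totPart, hc, totPart_zero])
      (suppCard_totPart ht _) fun F hF =>
        locPart_eq_zero (fun v hv h => h (hv l hF)) _) hc ht
  -- The remaining part is split by total degree, where `h` applies to each piece. Finitely many
  -- pieces suffice because the degrees of a cochain are bounded above.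
  have h2 : ∀ N : ℕ, totPart (fun v => (∀ l, 0 ≤ v l) ∧ ∑ l, v l < N) c ∈
      LinearMap.range (totD X _) := by
    intro N
    induction N with
    | zero =>
      suffices e : totPart (fun v => (∀ l, 0 ≤ v l) ∧ ∑ l, v l < (0 : ℕ)) c = 0 by
        rw [e]
        exact zero_mem _
      funext F
      refine locPart_eq_zero ?_ _
      rintro v - ⟨h1, h2⟩
      have := Finset.sum_nonneg fun l (_ : l ∈ Finset.univ) => h1 l
      push_cast at h2
      omega
    | succ N ih =>
      have e : totPart (fun v => (∀ l, 0 ≤ v l) ∧ ∑ l, v l < (N + 1 : ℕ)) c =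
          totPart (fun v => (∀ l, 0 ≤ v l) ∧ ∑ l, v l < N) c +
            totPart (degEq N) (totPart (fun v => ∀ l, 0 ≤ v l) c) := by
        rw [totPart_totPart, ← totPart_or]
        · congr 1
          funext v
          refine propext ?_
          rw [degEq]
          push_cast
          constructor
          · rintro ⟨h1, h2⟩
            rcases (Int.lt_add_one_iff.mp h2).lt_or_eq with h | h
            exacts [Or.inl ⟨h1, h⟩, Or.inr ⟨h, h1⟩]
          · rintro (⟨h1, h2⟩ | ⟨h1, h2⟩)
            exacts [⟨h1, by omega⟩, ⟨h2, by omega⟩]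
        · rintro v ⟨⟨-, h1⟩, h2, -⟩
          exact h1.ne h2
      rw [e]
      refine add_mem ih ?_
      obtain ⟨w, hw⟩ := exists_cocycle X
        (suppCard_totPart (suppCard_totPart ht fun v => ∀ l, 0 ≤ v l) (degEq N))
        (by rw [totD_totPart, totD_totPart, hc, totPart_zero, totPart_zero])
      rw [← hw, ← cechCohomology_mk_eq_zero_iff, ← AddSubgroup.mem_bot, ← h N (by positivity)]
      refine ⟨w, fun F => ?_, rfl⟩
      rw [← extCochain_apply X w.1 F.2, hw]
      exact locPart_mem_locDegreePart _ _ _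
  obtain ⟨N, hN⟩ : ∃ N : ℕ, totPart (fun v => (∀ l, 0 ≤ v l) ∧ (N : ℤ) ≤ ∑ l, v l) c = 0 := by
    choose N hN using fun F => exists_locPart_eq_zero (c F)
    refine ⟨Finset.univ.sup N, funext fun F => hN F _ fun v hv => ?_⟩
    exact le_trans (by exact_mod_cast Finset.le_sup (f := N) (Finset.mem_univ F)) hv.2
  have h3 : totPart (fun v => ∀ l, 0 ≤ v l) c =
      totPart (fun v => (∀ l, 0 ≤ v l) ∧ ∑ l, v l < N) c := by
    rw [← add_zero (totPart (fun v => (∀ l, 0 ≤ v l) ∧ ∑ l, v l < N) c), ← hN, ← totPart_or]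
    · congr 1
      funext v
      refine propext ⟨fun h => ?_, ?_⟩
      · rcases lt_or_ge (∑ l, v l) N with h' | h'
        exacts [Or.inl ⟨h, h'⟩, Or.inr ⟨h, h'⟩]
      · rintro (h | h) <;> exact h.1
    · rintro v ⟨⟨-, h1⟩, -, h2⟩
      omega
  have := add_mem h1 (h3 ▸ h2 N)
  rwa [sub_add_cancel] at this

end Quotient

end Vanishing

/-! ### Descent of homogeneous cocycles along a linear resolution. -/

section LinearResolution

open MonomialFilter MonomialDiv

variable {K : Type*} [Field K] {n : ℕ}

theorem filt_mulVec {b b' : ℕ} {φ : Matrix (Fin b) (Fin b') (MvPolynomial (Fin n) K)}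
    (hφ : ∀ i j, (φ i j).IsHomogeneous 1) (e : ℤ) (v : Fin b' → MvPolynomial (Fin n) K) :
    filt K (fun a : Fin n →₀ ℕ => (a.degree : ℤ) = e + 1) (φ.mulVecLin v) =
      φ.mulVecLin (filt K (fun a : Fin n →₀ ℕ => (a.degree : ℤ) = e) v) := by
  funext i
  rw [filt_pi_apply]
  simp only [Matrix.mulVecLin_apply, Matrix.mulVec, dotProduct, map_sum, filt_pi_apply]
  refine Finset.sum_congr rfl fun j _ => ?_
  have := termFilter_mul_of_isHomogeneous (hφ i j) e (v j)
  exact_mod_cast this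

theorem filt_linearCombination {b q : ℕ} {g : Fin b → MvPolynomial (Fin n) K}
    (hg : ∀ i, (g i).IsHomogeneous q) (e : ℤ) (v : Fin b → MvPolynomial (Fin n) K) :
    filt K (fun a : Fin n →₀ ℕ => (a.degree : ℤ) = e + q)
        (Fintype.linearCombination (MvPolynomial (Fin n) K) g v) =
      Fintype.linearCombination (MvPolynomial (Fin n) K) g
        (filt K (fun a : Fin n →₀ ℕ => (a.degree : ℤ) = e) v) := by
  rw [filt_eq_termFilter]
  simp only [Fintype.linearCombination_apply, map_sum, filt_pi_apply, smul_eq_mul]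
  refine Finset.sum_congr rfl fun j _ => ?_
  rw [mul_comm, termFilter_mul_of_isHomogeneous (hg j), mul_comm]

section Lift

variable {M N : Type*} [AddCommGroup M] [Module (MvPolynomial (Fin n) K) M] [MonomialFilter K n M]
  [AddCommGroup N] [Module (MvPolynomial (Fin n) K) N] [MonomialFilter K n N]

/-- A homogeneous cochain in the image of a homogeneous map has a homogeneous preimage. -/
theorem exists_homogeneous_lift {ψ : M →ₗ[MvPolynomial (Fin n) K] N} {r j : ℤ} {t : ℕ}
    (hψ : ∀ (e : ℤ) m, filt K (fun a : Fin n →₀ ℕ => (a.degree : ℤ) = e + r) (ψ m) =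
      ψ (filt K (fun a : Fin n →₀ ℕ => (a.degree : ℤ) = e) m))
    {y : TotCochain (X : Fin n → MvPolynomial (Fin n) K) N} (ht : SuppCard X t y)
    (hy : totPart (degEq (j + r)) y = y) (hb : ∃ b, totMap X ψ b = y) :
    ∃ b, totMap X ψ b = y ∧ SuppCard X t b ∧ totPart (degEq j) b = b := by
  obtain ⟨b, rfl⟩ := hb
  -- Any lift may be cut down to the right cardinality and degree, since both truncations commute
  -- with `ψ` up to the shift `r`.
  refine ⟨totPart (degEq j) (resCard X t b), ?_, suppCard_totPart (suppCard_resCard X t b) _, ?_⟩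
  · rw [← totPart_totMap hψ, ← resCard_totMap, ht.resCard_eq, hy]
  · rw [totPart_totPart]
    simp only [and_self]

end Lift

/-- The descent along a linear free resolution. -/
theorem exists_eq_totD_add_totMap {β : ℕ → ℕ}
    {φ : ∀ k, Matrix (Fin (β k)) (Fin (β (k + 1))) (MvPolynomial (Fin n) K)}
    (hφ : ∀ k a b, (φ k a b).IsHomogeneous 1)
    (hex : ∀ k, LinearMap.ker (φ k).mulVecLin = LinearMap.range (φ (k + 1)).mulVecLin)
    (s : ℕ) : ∀ (t m : ℕ) (e : ℤ)
    (y : TotCochain (X : Fin n → MvPolynomial (Fin n) K)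
      (Fin (β m) → MvPolynomial (Fin n) K)), t + s = n → -(t : ℤ) < e → SuppCard X t y →
      totPart (degEq e) y = y → (∃ b, totMap X (φ m).mulVecLin b = totD X _ y) →
      ∃ w u, y = totD X _ w + totMap X (φ m).mulVecLin u := by
  induction s with
  | zero =>
    rintro t m e y hts he ht hy -
    obtain rfl : t = n := hts
    obtain ⟨w, hw⟩ := mem_range_of_degEq he ht hy
    -- In top cochain degree and internal degree greater than `-n`, `y` is itself a coboundary.
    exact ⟨w, 0, by rw [hw, map_zero, add_zero]⟩
  | succ s ih =>
    intro t m e y hts he ht hy hb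
    have hDy : totPart (degEq ((e - 1) + 1)) (totD X _ y) = totD X _ y := by
      rw [sub_add_cancel, ← totD_totPart, hy]
    obtain ⟨b, hb1, hb2, hb3⟩ := exists_homogeneous_lift (filt_mulVec (hφ m)) ht.totD hDy hb
    have hD : totMap X (φ m).mulVecLin (totD X _ b) = 0 := by
      rw [← totD_totMap, hb1, totD_totD]
    have hE := LinearMap.exact_iff.mpr (hex m)
    -- The entries of `φ m` are linear, so `t` rises and `e` falls by one, which preserves `-t < e`.
    obtain ⟨w, u, hwu⟩ := ih (t + 1) (m + 1) (e - 1) b (by omega) (by push_cast; omega) hb2 hb3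
      ((totMap_exact X hE _).mp hD)
    have h0 : totMap X (φ m).mulVecLin (totMap X (φ (m + 1)).mulVecLin u) = 0 :=
      (totMap_exact X hE _).mpr ⟨u, rfl⟩
    have hw : totMap X (φ m).mulVecLin (totD X _ (resCard X t w)) = totD X _ y := by
      rw [totD_resCard, ← resCard_totMap, ← ht.totD.resCard_eq, ← hb1, hwu, map_add, h0, add_zero]
    -- Correcting `y` by the image of `w` gives a cocycle of a free module below cochain degree `n`.
    obtain ⟨v, hv⟩ := mem_range_of_lt (t := t) (by omega)
      (c := y - totMap X (φ m).mulVecLin (resCard X t w))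
      (by rw [map_sub, totD_totMap, hw, sub_self])
      (ht.sub fun F hF => totMap_apply_of_eq_zero _ _ (suppCard_resCard X t w F hF))
    exact ⟨v, resCard X t w, by rw [hv, sub_add_cancel]⟩

/-- If `I` has a `q`-linear resolution and `i < n`, then `H^i(S/I)` vanishes in the degrees
`j ≥ q - i`. -/
theorem localCohDegreePart_eq_bot {I : Ideal (MvPolynomial (Fin n) K)}
    [Fact (IsMonomialIdeal I)] {q : ℕ} (hq : HasLinearResolution I q) {i : ℕ} (hi : i < n)
    {j : ℤ} (hij : (q : ℤ) ≤ i + j) : localCohDegreePart I i j = ⊥ := by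
  obtain ⟨β, g, φ, hg, hφ, hspan, hex0, hex⟩ := hq
  rw [eq_bot_iff]
  rintro _ ⟨z, hz, rfl⟩
  rw [AddSubgroup.mem_bot, cechCohomology_mk_eq_zero_iff]
  have hc := (mem_cechCocycles_iff _).mp z.2
  have ht := suppCard_extCochain (X : Fin n → MvPolynomial (Fin n) K) z.1
  have hdeg : totPart (degEq (j + 0)) (extCochain X i z.1) = extCochain X i z.1 := by
    funext F
    rw [totPart_apply, add_zero]
    by_cases hF : F.card = i
    · rw [extCochain_apply X _ hF]
      exact locPart_eq_self_of_mem (hz ⟨F, hF⟩)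
    · rw [ht F hF, map_zero]
  set c := extCochain X i z.1
  obtain ⟨y, hy1, hy2, hy3⟩ := exists_homogeneous_lift (ψ := I.mkQ) (r := 0)
    (fun e m => by rw [add_zero]; rfl) ht hdeg (totMap_surjective X I.mkQ_surjective c)
  have hE : Function.Exact (Fintype.linearCombination (MvPolynomial (Fin n) K) g) I.mkQ := by
    rw [LinearMap.exact_iff, Submodule.ker_mkQ, Fintype.range_linearCombination]
    exact hspan.symm
  have hE0 := LinearMap.exact_iff.mpr hex0
  obtain ⟨b, hb1, hb2, hb3⟩ := exists_homogeneous_lift (j := j - q) (filt_linearCombination hg)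
    hy2.totD (by rw [sub_add_cancel, ← totD_totPart, hy3])
    ((totMap_exact X hE _).mp (by rw [← totD_totMap, hy1, hc]))
  -- The required bound `-(i + 1) < j - q` is exactly `q ≤ i + j`.
  obtain ⟨w, u, hwu⟩ := exists_eq_totD_add_totMap hφ hex (n - (i + 1)) (i + 1) 0 (j - q) b
    (by omega) (by push_cast; omega) hb2 hb3
    ((totMap_exact X hE0 _).mp (by rw [← totD_totMap, hb1, totD_totD]))
  set γ := Fintype.linearCombination (MvPolynomial (Fin n) K) g
  have h0 : totMap X γ (totMap X (φ 0).mulVecLin u) = 0 := (totMap_exact X hE0 _).mpr ⟨u, rfl⟩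
  have hw : totMap X γ (totD X _ (resCard X i w)) = totD X _ y := by
    rw [totD_resCard, ← resCard_totMap, ← hy2.totD.resCard_eq, ← hb1, hwu, map_add, h0, add_zero]
  obtain ⟨v, hv⟩ := mem_range_of_lt hi (c := y - totMap X γ (resCard X i w))
    (by rw [map_sub, totD_totMap, hw, sub_self])
    (hy2.sub fun F hF => totMap_apply_of_eq_zero _ _ (suppCard_resCard X i w F hF))
  -- The correction term lies in the image of `γ` and dies in `S/I`, so `v` maps to a cochain
  -- bounding `c`.
  refine ⟨totMap X I.mkQ v, ?_⟩
  rw [totD_totMap, hv, map_sub, hy1, (totMap_exact X hE _).mpr ⟨_, rfl⟩, sub_zero]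

end LinearResolution

/-! ### Regularity, the dimension bound and the conclusion. -/

theorem add_le_reg {K : Type*} [Field K] {n : ℕ} {I : Ideal (MvPolynomial (Fin n) K)} {i : ℕ}
    {j : ℤ} (h : localCohDegreePart I i j ≠ ⊥) :
    (((i + j : ℤ) : WithTop ℤ) : WithBot (WithTop ℤ)) ≤ reg I :=
  le_sSup ⟨i, j, h, rfl⟩

theorem lt_of_lt_ringKrullDim_quotient {K : Type*} [Field K] {n : ℕ}
    {I : Ideal (MvPolynomial (Fin n) K)} {i : ℕ}
    (h : (i : WithBot ℕ∞) < ringKrullDim (MvPolynomial (Fin n) K ⧸ I)) : i < n := by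
  have h1 := h.trans_le (ringKrullDim_quotient_le I)
  rw [MvPolynomial.ringKrullDim_of_isNoetherianRing, ringKrullDim_eq_zero_of_field, zero_add,
    Nat.card_fin] at h1
  exact_mod_cast h1

end

theorem mainTheorem6 {K : Type*} [Field K] {n : ℕ} (I : Ideal (MvPolynomial (Fin n) K))
    (hI : IsMonomialIdeal I) (hCM : IsGeneralizedCM I) :
    (∀ i : ℕ, reg I + 1 ≤ (((i : ℤ) : WithTop ℤ) : WithBot (WithTop ℤ)) →
      (i : WithBot ℕ∞) < ringKrullDim (MvPolynomial (Fin n) K ⧸ I) →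
      Subsingleton (LocalCoh I i)) ∧
    (∀ q : ℕ, HasLinearResolution I q → ∀ i : ℕ, q ≤ i →
      (i : WithBot ℕ∞) < ringKrullDim (MvPolynomial (Fin n) K ⧸ I) →
      Subsingleton (LocalCoh I i)) := by
  have : Fact (IsMonomialIdeal I) := ⟨hI⟩
  have hN : ∀ i : ℕ, (i : WithBot ℕ∞) < ringKrullDim (MvPolynomial (Fin n) K ⧸ I) →
      IsNoetherian (MvPolynomial (Fin n) K) (LocalCoh I i) := fun i hi =>
    (isFiniteLength_iff_isNoetherian_isArtinian.mp (hCM i hi.ne)).1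
  refine ⟨fun i hr hi => ?_, fun q hq i hqi hi => ?_⟩
  · have := hN i hi
    refine subsingleton_localCoh fun j hj => ?_
    by_contra h
    -- A nonzero component of degree `j ≥ 0` would give `i + j + 1 ≤ reg I + 1 ≤ i`.
    have h1 := (add_le_add_left (add_le_reg h) 1).trans hr
    have h2 : ((i : ℤ) + j + 1 : ℤ) ≤ (i : ℤ) := by exact_mod_cast h1
    omega
  -- For `i ≥ q` and `j ≥ 0` one has `i + j ≥ q`, so the descent applies directly and the regularity
  -- is not needed.
  · have := hN i hi
    exact subsingleton_localCoh fun j hj =>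
      localCohDegreePart_eq_bot hq (lt_of_lt_ringKrullDim_quotient hi) (by omega)
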